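/- Let $d\ge 1$, let $\Omega\subset\mathbb{R}^d$ be a bounded domain (nonempty, open, connected) with $\partial\Omega\in C^2$ and outer unit normal $\mathbf n$, let $\Gamma\subset\partial\Omega$ be Borel, let $T>0$, $\mathcal T=[0,T]$ and $Q=\Omega\times(0,T)$. Let $\mathcal L:H^2(Q)\to L^2(Q)$ be a linear operator that is Lipschitz continuous (for instance a linear differential operator of order at most two whose coefficients are Lipschitz continuous on $\bar\Omega\times\mathcal T$). Let $f,g:\Gamma\times\mathcal T\to\mathbb R$ and $h\in C^2(\bar\Omega)$ with bounded first derivative. Assume that the Cauchy problem $$\frac{\partial u}{\partial t}+\mathcal L u=0\ \text{ in }\Omega\times\mathcal T,\qquad u=f\ \text{ and }\ \frac{\partial u}{\partial\mathbf n}=g\ \text{ on }\Gamma\times\mathcal T,\qquad u(\cdot,0)=h\ \text{ in }\Omega$$ has a unique solution $u$ in $H^2(Q)$, where the equation holds almost everywhere and the boundary and initial data are attained in the sense of traces. For functions $\psi:\mathbb{R}^d\times\mathbb{R}\to\mathbb{R}$ put $$J(\psi)=\Big\|\frac{\partial\psi}{\partial t}+\mathcal L\psi\Big\|^2_{L^2(\Omega\times\mathcal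 T)}+\|\psi-f\|^2_{L^2(\Gamma\times\mathcal T)}+\Big\|\frac{\partial\psi}{\partial\mathbf n}-g\Big\|^2_{L^2(\Gamma\times\mathcal T)}+\|\psi(\cdot,0)-h\|^2_{L^2(\Omega)},$$ with $J(\psi)=\infty$ if $\psi\notin H^2(Q)$, and let $K=\max(|\Omega\times\mathcal T|,|\Gamma\times\mathcal T|,|\Omega|)$, where $\Gamma$ carries the surface measure. Let $D\ge1$ and let $\sigma_1,\dots,\sigma_D:\mathbb R\to[0,1]$ be non-constant activation functions of class $C^2$. Consider the fully connected feedforward networks with $D$ hidden layers of arbitrary widths, that is, the functions $$\psi(\mathbf x,t)=\sum_{i}\xi_i\,y^D_i,\qquad y^0=(\mathbf x,t),\qquad y^{l}=\sigma_{l}\big(\mathbf w^{l}y^{l-1}+\mathbf b^{l}\big)\quad(1\le l\le D),$$ with $\sigma_l$ applied componentwise and with arbitrary real weights $\mathbf w^l$, biases $\mathbf b^l$ and output coefficients $\xi_i$. Then for every $\varepsilon>0$ there is a sequence $(\psi^n)_{n\in\mathbb{N}}$ of such networks with $J(\psi^n)<K\varepsilon$ for all $n$. -/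

import Mathlib

open MeasureTheory Set Filter Topology
open scoped ENNReal NNReal ContDiff

noncomputable section

/-- Space-time `ℝ^d × ℝ`, with points `(x, t)`. -/
abbrev SpaceTime (d : ℕ) : Type := EuclideanSpace ℝ (Fin d) × ℝ

/-- The coordinate directions of space-time: `some i` is the `i`-th spatial direction and `none`
is the time direction. -/
def coordDir {d : ℕ} : Option (Fin d) → SpaceTime d
  | some i => (EuclideanSpace.single i 1, 0)
  | none => (0, 1)

/-! ### The Sobolev space `H²` -/

/-- `L²(Q)` for a set `Q` in space-time. -/
abbrev L2 {d : ℕ} (Q : Set (SpaceTime d)) : Type := Lp ℝ 2 (volume.restrict Q)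

/-- `w ∈ L²(Q)` is the weak derivative of `u ∈ L²(Q)` in the direction `v` on `Q`: one has
`∫_Q u ∂_v φ = - ∫_Q w φ` for all test functions `φ ∈ C_c^∞(Q)`. -/
def IsWeakDeriv {d : ℕ} (Q : Set (SpaceTime d)) (v : SpaceTime d) (u w : L2 Q) : Prop :=
  ∀ φ : SpaceTime d → ℝ, ContDiff ℝ ∞ φ → HasCompactSupport φ → tsupport φ ⊆ Q →
    ∫ z in Q, u z * fderiv ℝ φ z v = - ∫ z in Q, w z * φ z

theorem integrable_L2_mul {d : ℕ} {Q : Set (SpaceTime d)} (u : L2 Q) {φ : SpaceTime d → ℝ}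
    (hφ : Continuous φ) (hc : HasCompactSupport φ) :
    Integrable (fun z => u z * φ z) (volume.restrict Q) :=
  (Lp.memLp u).integrable_mul
    (hφ.memLp_of_hasCompactSupport hc : MemLp φ 2 (volume.restrict Q))

theorem integrable_L2_mul_fderiv {d : ℕ} {Q : Set (SpaceTime d)} (u : L2 Q)
    {φ : SpaceTime d → ℝ} (hφ : ContDiff ℝ ∞ φ) (hc : HasCompactSupport φ) (v : SpaceTime d) :
    Integrable (fun z => u z * fderiv ℝ φ z v) (volume.restrict Q) :=
  integrable_L2_mul u ((hφ.continuous_fderiv (by simp)).clm_apply continuous_const)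
    (hc.fderiv_apply ℝ v)

theorem IsWeakDeriv.zero {d : ℕ} {Q : Set (SpaceTime d)} {v : SpaceTime d} :
    IsWeakDeriv Q v 0 0 := by
  intro φ _ _ _
  have h : ∀ ψ : SpaceTime d → ℝ, ∫ z in Q, ((0 : L2 Q) : SpaceTime d → ℝ) z * ψ z = 0 := by
    intro ψ
    rw [integral_eq_zero_of_ae]
    filter_upwards [Lp.coeFn_zero ℝ 2 (volume.restrict Q)] with z hz
    rw [hz, Pi.zero_apply, zero_mul]
  rw [h, h, neg_zero]

theorem IsWeakDeriv.add {d : ℕ} {Q : Set (SpaceTime d)} {v : SpaceTime d} {u₁ u₂ w₁ w₂ : L2 Q}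
    (h₁ : IsWeakDeriv Q v u₁ w₁) (h₂ : IsWeakDeriv Q v u₂ w₂) :
    IsWeakDeriv Q v (u₁ + u₂) (w₁ + w₂) := by
  intro φ hφ hc hs
  have hadd : ∀ (a b : L2 Q) (ψ : SpaceTime d → ℝ),
      Integrable (fun z => a z * ψ z) (volume.restrict Q) →
      Integrable (fun z => b z * ψ z) (volume.restrict Q) →
      ∫ z in Q, (a + b : L2 Q) z * ψ z = (∫ z in Q, a z * ψ z) + ∫ z in Q, b z * ψ z := by
    intro a b ψ ha hb
    rw [← integral_add ha hb]
    refine integral_congr_ae ?_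
    filter_upwards [Lp.coeFn_add a b] with z hz
    rw [hz, Pi.add_apply, add_mul]
  rw [hadd _ _ _ (integrable_L2_mul_fderiv u₁ hφ hc v) (integrable_L2_mul_fderiv u₂ hφ hc v),
    hadd _ _ _ (integrable_L2_mul w₁ hφ.continuous hc) (integrable_L2_mul w₂ hφ.continuous hc),
    h₁ φ hφ hc hs, h₂ φ hφ hc hs]
  ring

theorem IsWeakDeriv.smul {d : ℕ} {Q : Set (SpaceTime d)} {v : SpaceTime d} {u w : L2 Q}
    (h : IsWeakDeriv Q v u w) (c : ℝ) : IsWeakDeriv Q v (c • u) (c • w) := by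
  intro φ hφ hc hs
  have hsmul : ∀ (a : L2 Q) (ψ : SpaceTime d → ℝ),
      ∫ z in Q, (c • a : L2 Q) z * ψ z = c * ∫ z in Q, a z * ψ z := by
    intro a ψ
    rw [← integral_const_mul]
    refine integral_congr_ae ?_
    filter_upwards [Lp.coeFn_smul c a] with z hz
    rw [hz, Pi.smul_apply, smul_eq_mul, mul_assoc]
  rw [hsmul, hsmul, h φ hφ hc hs, mul_neg]

/-- The Sobolev space `H²(Q)`. An element is stored as `(u, (∂ᵢ u)ᵢ, (∂ⱼ ∂ᵢ u)ᵢⱼ)`, a function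
`u ∈ L²(Q)` together with its weak derivatives of orders one and two, all in `L²(Q)`; on an open
set `Q` the derivatives are determined by `u`. The norm is the maximum of the `L²(Q)`-norms of
all the components, which is equivalent to the usual Hilbert norm of `H²(Q)`. -/
def H2 {d : ℕ} (Q : Set (SpaceTime d)) :
    Submodule ℝ (L2 Q × (Option (Fin d) → L2 Q) × (Option (Fin d) → Option (Fin d) → L2 Q)) where
  carrier := {U | (∀ i, IsWeakDeriv Q (coordDir i) U.1 (U.2.1 i)) ∧
    ∀ i j, IsWeakDeriv Q (coordDir j) (U.2.1 i) (U.2.2 i j)}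
  zero_mem' := ⟨fun _ => IsWeakDeriv.zero, fun _ _ => IsWeakDeriv.zero⟩
  add_mem' := fun hU hV => ⟨fun i => (hU.1 i).add (hV.1 i), fun i j => (hU.2 i j).add (hV.2 i j)⟩
  smul_mem' := fun c _ hU => ⟨fun i => (hU.1 i).smul c, fun i j => (hU.2 i j).smul c⟩

/-- The weak time derivative `∂u/∂t ∈ L²(Q)` of `U ∈ H²(Q)`. -/
def timeDeriv {d : ℕ} {Q : Set (SpaceTime d)} (U : H2 Q) : L2 Q := U.1.2.1 none

/-- `U ∈ H²(Q)` is the class of the function `φ`, i.e. `U = φ` almost everywhere on `Q`. -/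
def IsClassOf {d : ℕ} {Q : Set (SpaceTime d)} (U : H2 Q) (φ : SpaceTime d → ℝ) : Prop :=
  (U.1.1 : SpaceTime d → ℝ) =ᵐ[volume.restrict Q] φ

/-! ### Boundary geometry -/

/-- `∂Ω ∈ C²`: near each of its boundary points, `Ω` is the part of space that lies above the
graph of a `C²` function over the hyperplane orthogonal to some unit vector `e`. -/
def HasC2Boundary {d : ℕ} (Ω : Set (EuclideanSpace ℝ (Fin d))) : Prop :=
  ∀ x ∈ frontier Ω, ∃ e : EuclideanSpace ℝ (Fin d), ‖e‖ = 1 ∧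
    ∃ γ : (Submodule.span ℝ {e})ᗮ → ℝ, ContDiff ℝ 2 γ ∧
      ∃ r > 0, ∀ y ∈ Metric.ball x r,
        (y ∈ Ω ↔ γ ((Submodule.span ℝ {e})ᗮ.orthogonalProjectionOnto y) < inner ℝ e y)

/-- `ν` is the outer unit normal of `Ω` at the boundary point `x`: up to an error `o(|y - x|)` as
`y → x`, the points `y` of `Ω` satisfy `⟨ν, y - x⟩ ≤ 0`, those outside of `Ω` satisfy
`⟨ν, y - x⟩ ≥ 0`. -/
def IsOuterUnitNormal {d : ℕ} (Ω : Set (EuclideanSpace ℝ (Fin d)))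
    (x ν : EuclideanSpace ℝ (Fin d)) : Prop :=
  ‖ν‖ = 1 ∧ ∀ δ > 0, ∀ᶠ y in 𝓝 x,
    (y ∈ Ω → inner ℝ ν (y - x) ≤ δ * ‖y - x‖) ∧ (y ∉ Ω → -(δ * ‖y - x‖) ≤ inner ℝ ν (y - x))

open Classical in
/-- The outer unit normal field `n` on `∂Ω` (zero at points where there is none). -/
def outerNormal {d : ℕ} (Ω : Set (EuclideanSpace ℝ (Fin d))) (x : EuclideanSpace ℝ (Fin d)) :
    EuclideanSpace ℝ (Fin d) :=
  if hx : ∃ ν, IsOuterUnitNormal Ω x ν then hx.choose else 0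

/-- The normal derivative `∂φ/∂n` at `(x, t)`, for `x ∈ ∂Ω`; it is taken in the space variable. -/
def normalDeriv {d : ℕ} (Ω : Set (EuclideanSpace ℝ (Fin d))) (φ : SpaceTime d → ℝ) :
    SpaceTime d → ℝ :=
  fun z => fderiv ℝ (fun x => φ (x, z.2)) z.1 (outerNormal Ω z.1)

/-- The product measure on `Γ × [0, T]` of the surface measure on `Γ` (the `(d-1)`-dimensional
Hausdorff measure, normalised as usual) and Lebesgue measure on `[0, T]`. -/
def lateralMeasure {d : ℕ} (Γ : Set (EuclideanSpace ℝ (Fin d))) (T : ℝ) :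
    Measure (SpaceTime d) :=
  ((μHE[d - 1] : Measure (EuclideanSpace ℝ (Fin d))).restrict Γ).prod
    (volume.restrict (Icc 0 T))

/-! ### The time-dependent Cauchy problem -/

/-- The space-time cylinder `Ω × (0, T)`. -/
abbrev stCylinder {d : ℕ} (Ω : Set (EuclideanSpace ℝ (Fin d))) (T : ℝ) : Set (SpaceTime d) :=
  Ω ×ˢ Ioo 0 T

/-- `w` is the trace of `U ∈ H²(Q)` with respect to the restriction map `R` and the measure `μ`:
the trace operator is the continuous extension to `H²(Q)` of the operator `φ ↦ R φ` on functions
of class `C²` up to the boundary, so whenever such functions `φₖ` converge to `U` in `H²(Q)`,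
the functions `R φₖ` converge to `w` in `L²(μ)`. -/
def HasTrace {d : ℕ} {Q : Set (SpaceTime d)} {X : Type*} [MeasurableSpace X]
    (R : (SpaceTime d → ℝ) → X → ℝ) (μ : Measure X) (U : H2 Q) (w : X → ℝ) : Prop :=
  ∀ (φ : ℕ → SpaceTime d → ℝ) (V : ℕ → H2 Q), (∀ k, ContDiff ℝ 2 (φ k)) →
    (∀ k, IsClassOf (V k) (φ k)) → Tendsto V atTop (𝓝 U) →
    Tendsto (fun k => eLpNorm (R (φ k) - w) 2 μ) atTop (𝓝 0)

/-- `U ∈ H²(Ω × (0, T))` solves the Cauchy problem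
`∂u/∂t + L u = 0` in `Ω × (0, T)`, `u = f` and `∂u/∂n = g` on `Γ × [0, T]`, `u(·, 0) = h` in `Ω`.
The equation holds almost everywhere and the data are attained in the sense of traces. -/
structure IsCauchySolution {d : ℕ} (Ω Γ : Set (EuclideanSpace ℝ (Fin d))) (T : ℝ)
    (L : H2 (stCylinder Ω T) →ₗ[ℝ] L2 (stCylinder Ω T)) (f g : SpaceTime d → ℝ)
    (h : EuclideanSpace ℝ (Fin d) → ℝ) (U : H2 (stCylinder Ω T)) : Prop where
  equation : timeDeriv U + L U = 0
  dirichlet : HasTrace (fun φ => φ) (lateralMeasure Γ T) U f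
  neumann : HasTrace (normalDeriv Ω) (lateralMeasure Γ T) U g
  initial : HasTrace (fun φ x => φ (x, 0)) (volume.restrict Ω) U h

/-- The cost functional
`J(ψ) = ‖∂ψ/∂t + L ψ‖² + ‖ψ - f‖² + ‖∂ψ/∂n - g‖² + ‖ψ(·, 0) - h‖²`, with the norms of
`L²(Ω × [0, T])`, `L²(Γ × [0, T])`, `L²(Γ × [0, T])` and `L²(Ω)`. In the first term, the infimum
runs over the only element of `H²(Ω × (0, T))` that is the class of `ψ`; the value is `∞` if
`ψ` is not in `H²(Ω × (0, T))`. -/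
def cost {d : ℕ} (Ω Γ : Set (EuclideanSpace ℝ (Fin d))) (T : ℝ)
    (L : H2 (stCylinder Ω T) →ₗ[ℝ] L2 (stCylinder Ω T)) (f g : SpaceTime d → ℝ)
    (h : EuclideanSpace ℝ (Fin d) → ℝ) (ψ : SpaceTime d → ℝ) : ℝ≥0∞ :=
  (⨅ (V : H2 (stCylinder Ω T)) (_ : IsClassOf V ψ), ‖timeDeriv V + L V‖ₑ ^ 2) +
    eLpNorm (ψ - f) 2 (lateralMeasure Γ T) ^ 2 +
    eLpNorm (normalDeriv Ω ψ - g) 2 (lateralMeasure Γ T) ^ 2 +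
    eLpNorm ((fun x => ψ (x, 0)) - h) 2 (volume.restrict Ω) ^ 2

/-- `K = max(|Ω × [0, T]|, |Γ × [0, T]|, |Ω|)`. -/
def costConst {d : ℕ} (Ω Γ : Set (EuclideanSpace ℝ (Fin d))) (T : ℝ) : ℝ :=
  max (max ((volume : Measure (SpaceTime d)).real (Ω ×ˢ Icc 0 T))
    ((lateralMeasure Γ T).real univ)) ((volume : Measure (EuclideanSpace ℝ (Fin d))).real Ω)

/-! ### Neural networks -/

/-- The weights and biases of the first `l` layers of a fully connected feedforward network with
`N` inputs; the last index is the number of units of layer `l`. The widths are arbitrary. -/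
inductive HiddenLayers (N : ℕ) : ℕ → ℕ → Type
  | input : HiddenLayers N 0 N
  | next {l m : ℕ} (y : HiddenLayers N l m) (n : ℕ) (w : Matrix (Fin n) (Fin m) ℝ)
      (b : Fin n → ℝ) : HiddenLayers N (l + 1) n

/-- The output of layer `l`: `y⁰` is the input and `y^{l+1} = σ_{l+1}(w^{l+1} y^l + b^{l+1})`
componentwise. -/
def HiddenLayers.eval {N : ℕ} (σ : ℕ → ℝ → ℝ) :
    {l n : ℕ} → HiddenLayers N l n → (Fin N → ℝ) → Fin n → ℝ
  | _, _, .input, x => x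
  | _, _, .next (l := l) y _ w b, x => fun i => σ (l + 1) (w.mulVec (y.eval σ x) i + b i)

/-- A network with `depth` hidden layers on `ℝ^d × ℝ`: hidden layers followed by one linear
output unit with coefficients `ξ`. -/
structure Network (d depth : ℕ) where
  width : ℕ
  hidden : HiddenLayers (d + 1) depth width
  ξ : Fin width → ℝ

/-- The function `(x, t) ↦ ∑ᵢ ξᵢ yᵢ(x, t)` computed by a network with activation functions `σ`,
where `y` is the output of its last hidden layer at the input `(x₁, …, x_d, t)`. -/
def Network.eval {d depth : ℕ} (ψ : Network d depth) (σ : ℕ → ℝ → ℝ) (z : SpaceTime d) : ℝ :=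
  ∑ i, ψ.ξ i * ψ.hidden.eval σ (Fin.snoc (fun j => z.1 j) z.2 : Fin (d + 1) → ℝ) i

end

/-!
The trace conditions in `IsCauchySolution` hold along *every* sequence of `C²` functions that
converges to the solution `U` in `H²(Q)`, `Q = Ω × (0, T)`, and `V ↦ ∂ₜV + L V` is continuous on
`H²(Q)`. Hence the cost of such functions tends to `0` (`IsCauchySolution.tendsto_cost`), whereas
`costConst` is positive, and all that is needed is that networks of the given depth are dense in
`H²(Q)` (`mem_closure_networkClasses`). The density is proved in four steps.

* *Smooth functions are dense* (`H2.mem_of_hasConeAt`). A bounded domain with `C²` boundary has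
  interior cones (`HasC2Boundary.hasConeAt`), and so has the cylinder `Q`, whose corners are only
  Lipschitz. After localization by a partition of unity, `U` is convolved with bumps supported in
  a ball of the reflected cone, so that only values of `U` in `Q` enter at points of `Q`; weak derivatives
  commute with this.
* *Ridge functions span a dense subspace of the smooth functions*
  (`ofContDiff_mem_of_hasCompactSupport`). By Fourier inversion, a smooth function with compact
  support is a superposition of plane waves `cos (ℓ z)` and `sin (ℓ z)`. The superposition
  converges as a Bochner integral in `H²(Q)`, because the `H²` norm of a wave grows polynomially
  in `ℓ` and the Fourier transform decays rapidly; so it stays in any closed subspace that contains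
  the waves.
* *Networks with one hidden layer approximate ridge functions* (`ofContDiff_comp_clm_mem`). For a
  bounded nonconstant `σ`, the dilates and translates of `σ''` span a dense subspace of the
  continuous functions on a compact interval (`topologicalClosure_span_affineComp_eq_top`).
  Integrating twice gives approximation of one-variable functions together with two derivatives, up
  to an affine function; affine functions are limits of the rescaled activation function
  (`approxIdentity`).
* *The remaining layers approximate the identity* (`span_subset_closure_networkClasses`). The same
  rescaling, `(σ (s₀ + δ s) - σ s₀) / (δ σ' s₀) → s` as `δ → 0`, makes all hidden layers but the
  last one approximately transparent, with convergence of derivatives up to order two. The affine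
  corrections are absorbed by the next layer.
-/

noncomputable section

/-! ### The space `H²(Q)` -/

section SobolevSpace

variable {d : ℕ} {Q : Set (SpaceTime d)}

instance : (volume : Measure (SpaceTime d)).IsAddHaarMeasure :=
  inferInstanceAs ((volume : Measure (EuclideanSpace ℝ (Fin d))).prod
    (volume : Measure ℝ)).IsAddHaarMeasure

theorem isFiniteMeasure_restrict_of_isBounded (hb : Bornology.IsBounded Q) :
    IsFiniteMeasure (volume.restrict Q) :=
  ⟨by rw [Measure.restrict_apply_univ]; exact hb.measure_lt_top⟩

theorem continuous_integral_L2_mul {ψ : SpaceTime d → ℝ} (hψ : MemLp ψ 2 (volume.restrict Q)) :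
    Continuous fun u : L2 Q => ∫ z in Q, u z * ψ z := by
  have h : (fun u : L2 Q => ∫ z in Q, u z * ψ z) = fun u : L2 Q => inner ℝ (hψ.toLp ψ) u := by
    funext u
    rw [L2.inner_def]
    refine integral_congr_ae ?_
    filter_upwards [hψ.coeFn_toLp] with z hz
    rw [hz]
    simp
  rw [h]
  exact continuous_const.inner continuous_id

theorem isClosed_setOf_isWeakDeriv (v : SpaceTime d) :
    IsClosed {p : L2 Q × L2 Q | IsWeakDeriv Q v p.1 p.2} := by
  simp only [IsWeakDeriv, Set.ofPred_forall]
  refine isClosed_iInter fun φ => isClosed_iInter fun hφ => isClosed_iInter fun hc =>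
    isClosed_iInter fun _ => ?_
  have h₁ : MemLp (fun z => fderiv ℝ φ z v) 2 (volume.restrict Q) :=
    ((hφ.continuous_fderiv (by simp)).clm_apply continuous_const).memLp_of_hasCompactSupport
      (hc.fderiv_apply ℝ v)
  have h₂ : MemLp φ 2 (volume.restrict Q) := hφ.continuous.memLp_of_hasCompactSupport hc
  exact isClosed_eq ((continuous_integral_L2_mul h₁).comp continuous_fst)
    ((continuous_integral_L2_mul h₂).comp continuous_snd).neg

theorem isClosed_H2 : IsClosed (H2 Q : Set (L2 Q × (Option (Fin d) → L2 Q) ×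
    (Option (Fin d) → Option (Fin d) → L2 Q))) := by
  have h : (H2 Q : Set (L2 Q × (Option (Fin d) → L2 Q) ×
      (Option (Fin d) → Option (Fin d) → L2 Q))) =
      (⋂ i, {U | IsWeakDeriv Q (coordDir i) U.1 (U.2.1 i)}) ∩
        ⋂ i, ⋂ j, {U | IsWeakDeriv Q (coordDir j) (U.2.1 i) (U.2.2 i j)} := by
    ext U
    simp only [mem_inter_iff, mem_iInter, mem_ofPred_eq]
    rfl
  rw [h]
  refine (isClosed_iInter fun i => ?_).inter (isClosed_iInter fun i => isClosed_iInter fun j => ?_)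
  · exact (isClosed_setOf_isWeakDeriv (coordDir i)).preimage
      (f := fun U : L2 Q × (Option (Fin d) → L2 Q) × (Option (Fin d) → Option (Fin d) → L2 Q) =>
        (U.1, U.2.1 i)) (by fun_prop)
  · exact (isClosed_setOf_isWeakDeriv (coordDir j)).preimage
      (f := fun U : L2 Q × (Option (Fin d) → L2 Q) × (Option (Fin d) → Option (Fin d) → L2 Q) =>
        (U.2.1 i, U.2.2 i j)) (by fun_prop)

instance : CompleteSpace (H2 Q) := isClosed_H2.completeSpace_coe

/-- The weak derivative on an open set is unique, by the fundamental lemma of the calculus of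
variations. -/
theorem IsWeakDeriv.unique (hQ : IsOpen Q) {v : SpaceTime d} {u w₁ w₂ : L2 Q}
    (h₁ : IsWeakDeriv Q v u w₁) (h₂ : IsWeakDeriv Q v u w₂) : w₁ = w₂ := by
  have h := h₁.add (h₂.smul (-1))
  have hu : u + (-1 : ℝ) • u = 0 := by simp
  rw [hu] at h
  have key : ∀ᵐ z ∂(volume.restrict Q), z ∈ Q → (w₁ + (-1 : ℝ) • w₂ : L2 Q) z = 0 := by
    refine hQ.ae_eq_zero_of_integral_contDiff_smul_eq_zero
      (((Lp.memLp _).locallyIntegrable one_le_two).locallyIntegrableOn _) fun φ hφ hc hs => ?_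
    have h' := h φ hφ hc hs
    have h0 : ∫ z in Q, ((0 : L2 Q) : SpaceTime d → ℝ) z * fderiv ℝ φ z v = 0 := by
      rw [integral_eq_zero_of_ae]
      filter_upwards [Lp.coeFn_zero ℝ 2 (volume.restrict Q)] with z hz
      rw [hz, Pi.zero_apply, zero_mul]
    rw [h0, eq_comm, neg_eq_zero] at h'
    rw [← h']
    simp only [smul_eq_mul, mul_comm]
  have hz : w₁ + (-1 : ℝ) • w₂ = 0 := by
    refine Lp.ext ?_
    filter_upwards [key, ae_restrict_mem hQ.measurableSet,
      Lp.coeFn_zero ℝ 2 (volume.restrict Q)] with z h1 h2 h3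
    rw [h1 h2, h3, Pi.zero_apply]
  rwa [neg_one_smul, ← sub_eq_add_neg, sub_eq_zero] at hz

/-- On an open set, an element of `H²(Q)` is determined by its underlying function. -/
theorem H2.ext_of_fst_eq (hQ : IsOpen Q) {U V : H2 Q} (h : U.1.1 = V.1.1) : U = V := by
  have h₁ : U.1.2.1 = V.1.2.1 := by
    funext i
    refine (U.2.1 i).unique hQ ?_
    rw [h]
    exact V.2.1 i
  have h₂ : U.1.2.2 = V.1.2.2 := by
    funext i j
    refine (U.2.2 i j).unique hQ ?_
    rw [h₁]
    exact V.2.2 i j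
  exact Subtype.ext (Prod.ext h (Prod.ext h₁ h₂))

theorem H2.norm_le {U : H2 Q} {r : ℝ} (hr : 0 ≤ r) (h₀ : ‖U.1.1‖ ≤ r)
    (h₁ : ∀ i, ‖U.1.2.1 i‖ ≤ r) (h₂ : ∀ i j, ‖U.1.2.2 i j‖ ≤ r) : ‖U‖ ≤ r := by
  change ‖U.1‖ ≤ r
  rw [Prod.norm_def, Prod.norm_def]
  refine sup_le h₀ (sup_le ((pi_norm_le_iff_of_nonneg hr).2 h₁) ?_)
  exact (pi_norm_le_iff_of_nonneg hr).2 fun i => (pi_norm_le_iff_of_nonneg hr).2 (h₂ i)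

/-! ### Functions of class `C²` as elements of `H²(Q)` -/

theorem Continuous.memLp_restrict_of_isBounded {φ : SpaceTime d → ℝ} (hφ : Continuous φ)
    (hb : Bornology.IsBounded Q) : MemLp φ 2 (volume.restrict Q) := by
  have := isFiniteMeasure_restrict_of_isBounded hb
  obtain ⟨C, hC⟩ := hb.isCompact_closure.exists_bound_of_continuousOn hφ.continuousOn
  exact MemLp.of_bound hφ.aestronglyMeasurable C
    (ae_restrict_of_ae_restrict_of_subset subset_closure
      (ae_restrict_of_forall_mem isClosed_closure.measurableSet hC))

/-- A classical derivative is a weak one. The function `φ` need not vanish anywhere: test functions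
vanish near the complement of `Q`, so the integration by parts takes place on the whole space. -/
theorem isWeakDeriv_toLp_of_contDiff (v : SpaceTime d)
    {φ φ' : SpaceTime d → ℝ} (hφ : ContDiff ℝ 1 φ) (hφ' : ∀ z, fderiv ℝ φ z v = φ' z)
    (h : MemLp φ 2 (volume.restrict Q)) (h' : MemLp φ' 2 (volume.restrict Q)) :
    IsWeakDeriv Q v (h.toLp φ) (h'.toLp φ') := by
  intro θ hθ hc hs
  have hcφ' : Continuous φ' := by
    have : φ' = fun z => fderiv ℝ φ z v := funext fun z => (hφ' z).symm
    rw [this]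
    exact (hφ.continuous_fderiv one_ne_zero).clm_apply continuous_const
  have hcθ' : Continuous fun z => fderiv ℝ θ z v :=
    (hθ.continuous_fderiv (by simp)).clm_apply continuous_const
  have hsθ : ∀ z, z ∉ Q → θ z = 0 := fun z hz =>
    image_eq_zero_of_notMem_tsupport fun hz' => hz (hs hz')
  have hsθ' : ∀ z, z ∉ Q → fderiv ℝ θ z v = 0 := fun z hz => by
    have : z ∉ tsupport (fderiv ℝ θ) := fun hz' => hz (hs (tsupport_fderiv_subset ℝ hz'))
    rw [image_eq_zero_of_notMem_tsupport this]
    rfl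
  have e₁ : ∫ z in Q, (h.toLp φ) z * fderiv ℝ θ z v = ∫ z, φ z * fderiv ℝ θ z v := by
    rw [← setIntegral_eq_integral_of_forall_compl_eq_zero (μ := volume) (s := Q)
      (fun z hz => by rw [hsθ' z hz, mul_zero])]
    exact integral_congr_ae (h.coeFn_toLp.mono fun z hz => by simp only [hz])
  have e₂ : ∫ z in Q, (h'.toLp φ') z * θ z = ∫ z, fderiv ℝ φ z v * θ z := by
    rw [← setIntegral_eq_integral_of_forall_compl_eq_zero (μ := volume) (s := Q)
      (fun z hz => by rw [hsθ z hz, mul_zero])]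
    exact integral_congr_ae (h'.coeFn_toLp.mono fun z hz => by simp only [hz, hφ'])
  rw [e₁, e₂]
  refine integral_mul_fderiv_eq_neg_fderiv_mul_of_integrable ?_ ?_ ?_
    (fun z _ => (hφ.differentiable one_ne_zero) z) (fun z _ => (hθ.differentiable (by simp)) z)
  · simp only [hφ']
    exact (hcφ'.mul hθ.continuous).integrable_of_hasCompactSupport hc.mul_left
  · exact (hφ.continuous.mul hcθ').integrable_of_hasCompactSupport (hc.fderiv_apply ℝ v).mul_left
  · exact (hφ.continuous.mul hθ.continuous).integrable_of_hasCompactSupport hc.mul_left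

theorem ContDiff.contDiff_fderiv_apply_const {φ : SpaceTime d → ℝ} (hφ : ContDiff ℝ 2 φ)
    (v : SpaceTime d) : ContDiff ℝ 1 fun z => fderiv ℝ φ z v :=
  (hφ.fderiv_right (m := 1) (by norm_num)).clm_apply contDiff_const

theorem ContDiff.continuous_fderiv_fderiv_apply {φ : SpaceTime d → ℝ} (hφ : ContDiff ℝ 2 φ)
    (v w : SpaceTime d) : Continuous fun z => fderiv ℝ (fun z => fderiv ℝ φ z v) z w :=
  ((hφ.contDiff_fderiv_apply_const v).continuous_fderiv one_ne_zero).clm_apply continuous_const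

/-- The element of `H²(Q)`, for a bounded set `Q`, that a function of class `C²` on all of
space-time defines; its weak derivatives are the classical ones. -/
def H2.ofContDiff (hb : Bornology.IsBounded Q) (φ : SpaceTime d → ℝ) (hφ : ContDiff ℝ 2 φ) :
    H2 Q :=
  ⟨((hφ.continuous.memLp_restrict_of_isBounded hb).toLp φ,
    fun i => ((hφ.contDiff_fderiv_apply_const
      (coordDir i)).continuous.memLp_restrict_of_isBounded hb).toLp _,
    fun i j => ((hφ.continuous_fderiv_fderiv_apply
      (coordDir i) (coordDir j)).memLp_restrict_of_isBounded hb).toLp _),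
    fun i => isWeakDeriv_toLp_of_contDiff _ (hφ.of_le (by norm_num)) (fun _ => rfl)
      (hφ.continuous.memLp_restrict_of_isBounded hb)
      ((hφ.contDiff_fderiv_apply_const (coordDir i)).continuous.memLp_restrict_of_isBounded hb),
    fun i j => isWeakDeriv_toLp_of_contDiff _ (hφ.contDiff_fderiv_apply_const (coordDir i))
      (fun _ => rfl)
      ((hφ.contDiff_fderiv_apply_const (coordDir i)).continuous.memLp_restrict_of_isBounded hb)
      ((hφ.continuous_fderiv_fderiv_apply
        (coordDir i) (coordDir j)).memLp_restrict_of_isBounded hb)⟩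

theorem H2.isClassOf_ofContDiff (hb : Bornology.IsBounded Q) {φ : SpaceTime d → ℝ}
    (hφ : ContDiff ℝ 2 φ) : IsClassOf (H2.ofContDiff hb φ hφ) φ :=
  (hφ.continuous.memLp_restrict_of_isBounded hb).coeFn_toLp

theorem H2.eq_ofContDiff (hQ : IsOpen Q) (hb : Bornology.IsBounded Q) {φ : SpaceTime d → ℝ}
    (hφ : ContDiff ℝ 2 φ) {U : H2 Q} (hU : IsClassOf U φ) : U = H2.ofContDiff hb φ hφ :=
  H2.ext_of_fst_eq hQ (Lp.ext (hU.trans (H2.isClassOf_ofContDiff hb hφ).symm))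

theorem H2.ofContDiff_add (hQ : IsOpen Q) (hb : Bornology.IsBounded Q) {φ ψ : SpaceTime d → ℝ}
    (hφ : ContDiff ℝ 2 φ) (hψ : ContDiff ℝ 2 ψ) :
    H2.ofContDiff hb (fun z => φ z + ψ z) (hφ.add hψ) =
      H2.ofContDiff hb φ hφ + H2.ofContDiff hb ψ hψ := by
  symm
  refine H2.eq_ofContDiff hQ hb _ ?_
  filter_upwards [Lp.coeFn_add (H2.ofContDiff hb φ hφ).1.1 (H2.ofContDiff hb ψ hψ).1.1,
    H2.isClassOf_ofContDiff hb hφ, H2.isClassOf_ofContDiff hb hψ] with z h₁ h₂ h₃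
  rw [← h₂, ← h₃]
  exact h₁

theorem H2.ofContDiff_const_mul (hQ : IsOpen Q) (hb : Bornology.IsBounded Q)
    {φ : SpaceTime d → ℝ} (hφ : ContDiff ℝ 2 φ) (c : ℝ) :
    H2.ofContDiff hb (fun z => c * φ z) (contDiff_const.mul hφ) = c • H2.ofContDiff hb φ hφ := by
  symm
  refine H2.eq_ofContDiff hQ hb _ ?_
  filter_upwards [Lp.coeFn_smul c (H2.ofContDiff hb φ hφ).1.1,
    H2.isClassOf_ofContDiff hb hφ] with z h₁ h₂
  rw [← h₂]
  exact h₁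

theorem H2.ofContDiff_sum (hQ : IsOpen Q) (hb : Bornology.IsBounded Q) {ι : Type*} (s : Finset ι)
    {φ : ι → SpaceTime d → ℝ} (hφ : ∀ i, ContDiff ℝ 2 (φ i)) :
    H2.ofContDiff hb (fun z => ∑ i ∈ s, φ i z) (ContDiff.sum fun i _ => hφ i) =
      ∑ i ∈ s, H2.ofContDiff hb (φ i) (hφ i) := by
  classical
  induction s using Finset.induction_on with
  | empty =>
    symm
    refine H2.eq_ofContDiff hQ hb _ ?_
    simp only [Finset.sum_empty]
    exact Lp.coeFn_zero ℝ 2 (volume.restrict Q)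
  | insert a s ha ih =>
    rw [Finset.sum_insert ha, ← ih, ← H2.ofContDiff_add hQ]
    congr 1
    funext z
    rw [Finset.sum_insert ha]

theorem norm_toLp_sub_toLp_le (hQ : IsOpen Q) [IsFiniteMeasure (volume.restrict Q)]
    {φ ψ : SpaceTime d → ℝ} (hφ : MemLp φ 2 (volume.restrict Q))
    (hψ : MemLp ψ 2 (volume.restrict Q)) {C : ℝ} (hC : 0 ≤ C)
    (hle : ∀ z ∈ Q, ‖φ z - ψ z‖ ≤ C) :
    ‖hφ.toLp φ - hψ.toLp ψ‖ ≤ measureUnivNNReal (volume.restrict Q) ^ (2 : ℝ)⁻¹ * C := by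
  rw [← MemLp.toLp_sub]
  have h := Lp.norm_le_of_ae_bound (f := (hφ.sub hψ).toLp (φ - ψ)) hC (by
    filter_upwards [(hφ.sub hψ).coeFn_toLp, ae_restrict_mem hQ.measurableSet] with z hz hzQ
    rw [hz]
    exact hle z hzQ)
  simpa only [ENNReal.toReal_ofNat] using h

/-- The norm of `H²(Q)` is controlled by the `C²`-norm on `Q`. -/
theorem H2.exists_norm_ofContDiff_sub_le (hQ : IsOpen Q) (hb : Bornology.IsBounded Q) :
    ∃ A : ℝ, 0 ≤ A ∧ ∀ (φ ψ : SpaceTime d → ℝ) (hφ : ContDiff ℝ 2 φ) (hψ : ContDiff ℝ 2 ψ)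
      (C : ℝ), 0 ≤ C → (∀ z ∈ Q, ‖φ z - ψ z‖ ≤ C) →
      (∀ z ∈ Q, ∀ i, ‖fderiv ℝ φ z (coordDir i) - fderiv ℝ ψ z (coordDir i)‖ ≤ C) →
      (∀ z ∈ Q, ∀ i j,
        ‖fderiv ℝ (fun z => fderiv ℝ φ z (coordDir i)) z (coordDir j) -
          fderiv ℝ (fun z => fderiv ℝ ψ z (coordDir i)) z (coordDir j)‖ ≤ C) →
      ‖H2.ofContDiff hb φ hφ - H2.ofContDiff hb ψ hψ‖ ≤ A * C := by
  have := isFiniteMeasure_restrict_of_isBounded hb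
  refine ⟨measureUnivNNReal (volume.restrict Q) ^ (2 : ℝ)⁻¹, by positivity,
    fun φ ψ hφ hψ C hC h₀ h₁ h₂ => ?_⟩
  refine H2.norm_le (by positivity) ?_ (fun i => ?_) (fun i j => ?_)
  · exact norm_toLp_sub_toLp_le hQ (hφ.continuous.memLp_restrict_of_isBounded hb)
      (hψ.continuous.memLp_restrict_of_isBounded hb) hC h₀
  · exact norm_toLp_sub_toLp_le hQ ((hφ.contDiff_fderiv_apply_const
      (coordDir i)).continuous.memLp_restrict_of_isBounded hb)
      ((hψ.contDiff_fderiv_apply_const (coordDir i)).continuous.memLp_restrict_of_isBounded hb)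
      hC fun z hz => h₁ z hz i
  · exact norm_toLp_sub_toLp_le hQ ((hφ.continuous_fderiv_fderiv_apply
      (coordDir i) (coordDir j)).memLp_restrict_of_isBounded hb)
      ((hψ.continuous_fderiv_fderiv_apply
        (coordDir i) (coordDir j)).memLp_restrict_of_isBounded hb) hC fun z hz => h₂ z hz i j

end SobolevSpace

/-! ### Continuous families of functions of class `C²` -/

section C2Family

/-- A family `F x : E → G` of functions of class `C²`, indexed by a topological space, whose
derivatives of orders zero, one and two are jointly continuous in the parameter `x` and the point
of `E`. -/
structure IsC2Family {X E G : Type*} [TopologicalSpace X] [NormedAddCommGroup E]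
    [NormedSpace ℝ E] [NormedAddCommGroup G] [NormedSpace ℝ G] (F : X → E → G) : Prop where
  contDiff : ∀ x, ContDiff ℝ 2 (F x)
  continuous : Continuous fun p : X × E => F p.1 p.2
  continuous_fderiv : Continuous fun p : X × E => fderiv ℝ (F p.1) p.2
  continuous_fderiv_fderiv : Continuous fun p : X × E => fderiv ℝ (fderiv ℝ (F p.1)) p.2

variable {X E G G' : Type*} [TopologicalSpace X] [NormedAddCommGroup E] [NormedSpace ℝ E]
  [NormedAddCommGroup G] [NormedSpace ℝ G] [NormedAddCommGroup G'] [NormedSpace ℝ G']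

namespace IsC2Family

theorem of_hasFDerivAt {F : X → E → G} {F' : X → E → E →L[ℝ] G} {F'' : X → E → E →L[ℝ] E →L[ℝ] G}
    (h₁ : ∀ x z, HasFDerivAt (F x) (F' x z) z) (h₂ : ∀ x z, HasFDerivAt (F' x) (F'' x z) z)
    (c₀ : Continuous fun p : X × E => F p.1 p.2) (c₁ : Continuous fun p : X × E => F' p.1 p.2)
    (c₂ : Continuous fun p : X × E => F'' p.1 p.2) : IsC2Family F := by
  have e₁ : ∀ x, fderiv ℝ (F x) = F' x := fun x => funext fun z => (h₁ x z).fderiv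
  have e₂ : ∀ x, fderiv ℝ (F' x) = F'' x := fun x => funext fun z => (h₂ x z).fderiv
  refine ⟨fun x => ?_, c₀, by simpa only [e₁] using c₁, by simpa only [e₁, e₂] using c₂⟩
  rw [show (2 : WithTop ℕ∞) = 1 + 1 by norm_num, contDiff_succ_iff_fderiv]
  refine ⟨fun z => (h₁ x z).differentiableAt, by simp, ?_⟩
  rw [e₁, contDiff_one_iff_fderiv, e₂]
  exact ⟨fun z => (h₂ x z).differentiableAt, c₂.comp (by fun_prop : Continuous fun z => (x, z))⟩

/-- For functions of a real variable, the derivatives of an `IsC2Family` may be given as numbers. -/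
theorem of_hasDerivAt {τ τ' τ'' : X → ℝ → ℝ}
    (h₁ : ∀ x s, HasDerivAt (τ x) (τ' x s) s) (h₂ : ∀ x s, HasDerivAt (τ' x) (τ'' x s) s)
    (c₀ : Continuous fun p : X × ℝ => τ p.1 p.2) (c₁ : Continuous fun p : X × ℝ => τ' p.1 p.2)
    (c₂ : Continuous fun p : X × ℝ => τ'' p.1 p.2) : IsC2Family τ :=
  let S : ∀ (V : Type) [NormedAddCommGroup V] [NormedSpace ℝ V], V →L[ℝ] ℝ →L[ℝ] V :=
    fun V _ _ => (ContinuousLinearMap.toSpanSingletonCLE (𝕜 := ℝ) (E := V)).toContinuousLinearMap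
  of_hasFDerivAt (F' := fun x s => S ℝ (τ' x s)) (F'' := fun x s => S _ (S ℝ (τ'' x s)))
    (fun x s => (h₁ x s).hasFDerivAt)
    (fun x s => ((S ℝ).hasFDerivAt.comp_hasDerivAt s (h₂ x s)).hasFDerivAt)
    c₀ ((S ℝ).continuous.comp c₁) ((S _).continuous.comp ((S ℝ).continuous.comp c₂))

theorem hasFDerivAt {F : X → E → G} (hF : IsC2Family F) (x : X) (z : E) :
    HasFDerivAt (F x) (fderiv ℝ (F x) z) z :=
  ((hF.contDiff x).differentiable (by norm_num) z).hasFDerivAt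

theorem hasFDerivAt_fderiv {F : X → E → G} (hF : IsC2Family F) (x : X) (z : E) :
    HasFDerivAt (fderiv ℝ (F x)) (fderiv ℝ (fderiv ℝ (F x)) z) z :=
  ((((hF.contDiff x).fderiv_right (m := 1) (by norm_num)).differentiable one_ne_zero)
    z).hasFDerivAt

theorem const {g : E → G} (hg : ContDiff ℝ 2 g) : IsC2Family fun _ : X => g where
  contDiff _ := hg
  continuous := hg.continuous.comp continuous_snd
  continuous_fderiv := (hg.continuous_fderiv (by norm_num)).comp continuous_snd
  continuous_fderiv_fderiv :=
    (((hg.fderiv_right (m := 1) (by norm_num)).continuous_fderiv one_ne_zero)).comp continuous_snd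

theorem add {F₁ F₂ : X → E → G} (h₁ : IsC2Family F₁) (h₂ : IsC2Family F₂) :
    IsC2Family fun x z => F₁ x z + F₂ x z :=
  of_hasFDerivAt (fun x z => (h₁.hasFDerivAt x z).add (h₂.hasFDerivAt x z))
    (fun x z => (h₁.hasFDerivAt_fderiv x z).add (h₂.hasFDerivAt_fderiv x z))
    (h₁.continuous.add h₂.continuous) (h₁.continuous_fderiv.add h₂.continuous_fderiv)
    (h₁.continuous_fderiv_fderiv.add h₂.continuous_fderiv_fderiv)

theorem clm_apply {ℓ : X → E →L[ℝ] G} (hℓ : Continuous ℓ) : IsC2Family fun x z => ℓ x z :=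
  of_hasFDerivAt (F' := fun x _ => ℓ x) (F'' := fun _ _ => 0) (fun x _ => (ℓ x).hasFDerivAt)
    (fun x _ => hasFDerivAt_const (ℓ x) _) (by fun_prop) (by fun_prop) continuous_const

theorem comp {τ : X → G → G'} {F : X → E → G} (hτ : IsC2Family τ) (hF : IsC2Family F) :
    IsC2Family fun x z => τ x (F x z) := by
  have c₀ : Continuous fun p : X × E => (p.1, F p.1 p.2) := continuous_fst.prodMk hF.continuous
  have hc₁ := hτ.continuous_fderiv.comp c₀
  have hc₂ := hτ.continuous_fderiv_fderiv.comp c₀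
  have hF₁ := hF.continuous_fderiv
  have hF₂ := hF.continuous_fderiv_fderiv
  refine of_hasFDerivAt (fun x z => (hτ.hasFDerivAt x (F x z)).comp z (hF.hasFDerivAt x z))
    (fun x z => ((hτ.hasFDerivAt_fderiv x (F x z)).comp z (hF.hasFDerivAt x z)).clm_comp
      (hF.hasFDerivAt_fderiv x z)) (hτ.continuous.comp c₀) (hc₁.clm_comp hF₁) ?_
  refine Continuous.add ?_ ?_
  · exact ((ContinuousLinearMap.compL ℝ E G G').continuous.comp hc₁).clm_comp hF₂
  · exact ((ContinuousLinearMap.compL ℝ E G G').flip.continuous.comp hF₁).clm_comp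
      (hc₂.clm_comp hF₁)

theorem const_mul {F : X → E → ℝ} (hF : IsC2Family F) (c : ℝ) :
    IsC2Family fun x z => c * F x z :=
  (const (X := X) (g := fun s : ℝ => c * s) (by fun_prop)).comp hF

theorem sum {ι : Type*} (s : Finset ι) {F : ι → X → E → G} (hF : ∀ i, IsC2Family (F i)) :
    IsC2Family fun x z => ∑ i ∈ s, F i x z := by
  classical
  induction s using Finset.induction_on with
  | empty => simpa using const (X := X) (E := E) (g := fun _ => (0 : G)) contDiff_const
  | insert a s ha ih => simpa only [Finset.sum_insert ha] using (hF a).add ih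

end IsC2Family

/-- A jointly continuous function is continuous in the parameter, uniformly on compact sets. -/
theorem eventually_forall_mem_norm_sub_lt {X E G : Type*} [TopologicalSpace X]
    [TopologicalSpace E] [NormedAddCommGroup G] {K : Set E} (hK : IsCompact K) {Φ : X × E → G}
    (hΦ : Continuous Φ) (x₀ : X) {ε : ℝ} (hε : 0 < ε) :
    ∀ᶠ x in 𝓝 x₀, ∀ z ∈ K, ‖Φ (x, z) - Φ (x₀, z)‖ < ε := by
  refine hK.eventually_forall_of_forall_eventually fun z _ => ?_
  have hc : Continuous fun p : X × E => ‖Φ p - Φ (x₀, p.2)‖ := by fun_prop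
  refine hc.continuousAt.eventually_lt continuousAt_const ?_
  simpa using hε

/-- A continuous family of functions of class `C²` is a continuous curve in `H²(Q)`. -/
theorem IsC2Family.continuous_ofContDiff {d : ℕ} {Q : Set (SpaceTime d)} (hQ : IsOpen Q)
    (hb : Bornology.IsBounded Q) {F : X → SpaceTime d → ℝ} (hF : IsC2Family F) :
    Continuous fun x => H2.ofContDiff hb (F x) (hF.contDiff x) := by
  obtain ⟨A, hA, hle⟩ := H2.exists_norm_ofContDiff_sub_le hQ hb
  rw [continuous_iff_continuousAt]
  intro x₀
  rw [ContinuousAt, tendsto_iff_norm_sub_tendsto_zero, Metric.tendsto_nhds]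
  intro ε hε
  have hK : IsCompact (closure Q) := hb.isCompact_closure
  have hδ : 0 < ε / (A + 1) := by positivity
  have e₂ : ∀ x z v w, fderiv ℝ (fun z => fderiv ℝ (F x) z v) z w =
      fderiv ℝ (fderiv ℝ (F x)) z w v := fun x z v w => by
    rw [((hF.hasFDerivAt_fderiv x z).clm_apply (hasFDerivAt_const v z)).fderiv]
    simp
  have c₁ : ∀ i, Continuous fun p : X × SpaceTime d => fderiv ℝ (F p.1) p.2 (coordDir i) :=
    fun i => hF.continuous_fderiv.clm_apply continuous_const
  have c₂ : ∀ i j, Continuous fun p : X × SpaceTime d =>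
      fderiv ℝ (fun z => fderiv ℝ (F p.1) z (coordDir i)) p.2 (coordDir j) := fun i j => by
    simp only [e₂]
    exact (hF.continuous_fderiv_fderiv.clm_apply continuous_const).clm_apply continuous_const
  filter_upwards [eventually_forall_mem_norm_sub_lt hK hF.continuous x₀ hδ,
    eventually_all.2 fun i => eventually_forall_mem_norm_sub_lt hK (c₁ i) x₀ hδ,
    eventually_all.2 fun i => eventually_all.2 fun j =>
      eventually_forall_mem_norm_sub_lt hK (c₂ i j) x₀ hδ] with x h₀ h₁ h₂
  have h := hle (F x) (F x₀) (hF.contDiff x) (hF.contDiff x₀) _ hδ.le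
    (fun z hz => (h₀ z (subset_closure hz)).le) (fun z hz i => (h₁ i z (subset_closure hz)).le)
    (fun z hz i j => (h₂ i j z (subset_closure hz)).le)
  rw [dist_zero_right, norm_norm]
  refine h.trans_lt ?_
  rw [mul_div_assoc', div_lt_iff₀ (by positivity)]
  nlinarith

end C2Family

/-! ### Density of dilates and translates in one variable -/

section OneVariable

theorem Submodule.integral_mem_of_forall_mem {α F : Type*} [MeasurableSpace α] {μ : Measure α}
    [NormedAddCommGroup F] [NormedSpace ℝ F] [CompleteSpace F] {M : Submodule ℝ F}
    (hM : IsClosed (M : Set F)) {f : α → F} (hf : ∀ a, f a ∈ M) : ∫ a, f a ∂μ ∈ M := by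
  have : CompleteSpace M := hM.completeSpace_coe
  have h := M.subtypeₗᵢ.integral_comp_comm (μ := μ) fun a => (⟨f a, hf a⟩ : M)
  simp only [Submodule.coe_subtypeₗᵢ, Submodule.subtype_apply] at h
  rw [h]
  exact Submodule.coe_mem _

theorem Submodule.mem_of_hasDerivAt {F : Type*} [NormedAddCommGroup F] [NormedSpace ℝ F]
    {M : Submodule ℝ F} (hM : IsClosed (M : Set F)) {c : ℝ → F} {c' : F} {t : ℝ}
    (hc : ∀ t, c t ∈ M) (h : HasDerivAt c c' t) : c' ∈ M :=
  hM.mem_of_tendsto h.tendsto_slope (Eventually.of_forall fun s => by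
    rw [slope_def_module]
    exact M.smul_mem _ (M.sub_mem (hc _) (hc _)))

/-- If `Φ (r, s)` has the continuous derivative `Ψ (r, s)` with respect to `r`, then the difference
quotients converge uniformly in `s`: `r ↦ Φ (r, ·)` is a primitive of `r ↦ Ψ (r, ·)`. -/
theorem ContinuousMap.hasDerivAt_curry {I : Type*} [TopologicalSpace I] [CompactSpace I]
    {Φ Ψ : ℝ × I → ℝ} (hΦ : Continuous Φ) (hΨ : Continuous Ψ)
    (h : ∀ r s, HasDerivAt (fun r => Φ (r, s)) (Ψ (r, s)) r) (r : ℝ) :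
    HasDerivAt (fun r => (⟨Φ, hΦ⟩ : C(ℝ × I, ℝ)).curry r)
      ((⟨Ψ, hΨ⟩ : C(ℝ × I, ℝ)).curry r) r := by
  have hc : Continuous fun r => (⟨Ψ, hΨ⟩ : C(ℝ × I, ℝ)).curry r := map_continuous _
  have e : (fun r => (⟨Φ, hΦ⟩ : C(ℝ × I, ℝ)).curry r) =
      fun r => (⟨Φ, hΦ⟩ : C(ℝ × I, ℝ)).curry 0 +
        ∫ q in (0 : ℝ)..r, (⟨Ψ, hΨ⟩ : C(ℝ × I, ℝ)).curry q := by
    funext r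
    ext s
    have h1 := (ContinuousMap.evalCLM ℝ s).intervalIntegral_comp_comm
      (hc.intervalIntegrable (μ := volume) 0 r)
    simp only [ContinuousMap.evalCLM_apply, ContinuousMap.curry_apply,
      ContinuousMap.coe_mk] at h1
    have h2 := intervalIntegral.integral_eq_sub_of_hasDerivAt (a := 0) (b := r)
      (fun q _ => h q s) ((show Continuous fun q => Ψ (q, s) by fun_prop).intervalIntegrable _ _)
    rw [ContinuousMap.add_apply, ← h1, h2]
    simp
  rw [e]
  exact (hc.integral_hasStrictDerivAt 0 r).hasDerivAt.const_add _

/-- A bounded smooth function on the line one of whose derivatives vanishes identically is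
constant. This goes by induction on the order of that derivative, as the increment
`x ↦ p (x + h) - p x` satisfies the same hypotheses with one derivative less. -/
theorem eq_of_iteratedDeriv_eq_zero_of_bounded (n : ℕ) {p : ℝ → ℝ} (hp : ContDiff ℝ ∞ p) {C : ℝ}
    (hC : ∀ x, |p x| ≤ C) (h0 : ∀ x, iteratedDeriv n p x = 0) (x y : ℝ) : p x = p y := by
  induction n generalizing p C x y with
  | zero =>
    simp only [iteratedDeriv_zero] at h0
    rw [h0, h0]
  | succ n ih =>
    have key : ∀ h x, p (x + h) - p x = p (0 + h) - p 0 := by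
      intro h x
      refine ih (p := fun x => p (x + h) - p x) (C := C + C) ?_ ?_ ?_ x 0
      · exact (hp.comp (contDiff_id.add contDiff_const)).sub hp
      · exact fun x => (abs_sub _ _).trans (add_le_add (hC _) (hC _))
      · intro x
        have hd : Differentiable ℝ (iteratedDeriv n p) :=
          hp.differentiable_iteratedDeriv n (by exact_mod_cast WithTop.coe_lt_top _)
        have hcon := is_const_of_deriv_eq_zero hd (fun x => by
          rw [← iteratedDeriv_succ]; exact h0 x)
        have hs : ContDiffAt ℝ n (fun x => p (x + h)) x :=
          ((hp.comp (contDiff_id.add contDiff_const)).of_le (by exact_mod_cast le_top)).contDiffAt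
        have hs' : ContDiffAt ℝ n p x := (hp.of_le (by exact_mod_cast le_top)).contDiffAt
        have := iteratedDeriv_sub hs hs'
        rw [show (fun x => p (x + h) - p x) = (fun x => p (x + h)) - p from rfl, this,
          iteratedDeriv_comp_add_const]
        simp only []
        rw [hcon (x + h) x, sub_self]
    -- The increments over a step `h` are all equal, so `p` is affine along the multiples of `h`,
    -- and bounded.
    have hz : ∀ h, p (0 + h) - p 0 = 0 := by
      intro h
      have hk : ∀ k : ℕ, p (k * h) = p 0 + k * (p (0 + h) - p 0) := by
        intro k
        induction k with
        | zero => simp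
        | succ k ihk =>
          have := key h (k * h)
          have e : (k : ℝ) * h + h = ((k + 1 : ℕ) : ℝ) * h := by push_cast; ring
          rw [e] at this
          push_cast at this ⊢
          linarith
      by_contra hne
      obtain ⟨k, hk'⟩ := exists_nat_gt ((C + C) / |p (0 + h) - p 0|)
      rw [div_lt_iff₀ (abs_pos.2 hne)] at hk'
      have h1 : (k : ℝ) * (p (0 + h) - p 0) = p (k * h) - p 0 := by rw [hk]; ring
      have h2 : |(k : ℝ) * (p (0 + h) - p 0)| ≤ C + C := by
        rw [h1]
        exact (abs_sub _ _).trans (add_le_add (hC _) (hC _))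
      rw [abs_mul, Nat.abs_cast] at h2
      linarith
    have h1 := hz x
    have h2 := hz y
    simp only [zero_add] at h1 h2
    linarith

/-- The derivative of a mollification may be put on the mollified function, if that is of class
`C¹`; it need not be bounded. -/
theorem deriv_convolution_eq_convolution_deriv {η g : ℝ → ℝ} (hη : ContDiff ℝ ∞ η)
    (hc : HasCompactSupport η) (hg : ContDiff ℝ 1 g) :
    deriv (fun x => ∫ t, η t * g (x - t)) = fun x => ∫ t, η t * deriv g (x - t) := by
  funext x
  have h1 := (hc.hasDerivAt_convolution_left (ContinuousLinearMap.mul ℝ ℝ)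
    (hη.of_le (by exact_mod_cast le_top)) (μ := volume) hg.continuous.locallyIntegrable x).deriv
  have hη' : Continuous (deriv η) := hη.continuous_deriv (by exact_mod_cast le_top)
  have hg' : Continuous (deriv g) := hg.continuous_deriv le_rfl
  simp only [convolution_def, ContinuousLinearMap.mul_apply'] at h1
  refine Eq.trans (show deriv (fun x => ∫ t, η t * g (x - t)) x =
    ∫ t, deriv η t * g (x - t) from h1) ?_
  have h2 := integral_mul_deriv_eq_deriv_mul_of_integrable (u := η) (u' := deriv η)
    (v := fun t => g (x - t)) (v' := fun t => -deriv g (x - t))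
    (fun t _ => (hη.differentiable (by simp) t).hasDerivAt)
    (fun t _ => by
      have h3 := ((hg.differentiable one_ne_zero (x - t)).hasDerivAt).comp_const_sub x t
      exact h3)
    ?_ ?_ ?_
  · simp only [mul_neg, integral_neg, neg_inj] at h2
    exact h2.symm
  · exact Continuous.integrable_of_hasCompactSupport (by fun_prop) hc.mul_right
  · exact Continuous.integrable_of_hasCompactSupport (by fun_prop) hc.deriv.mul_right
  · exact Continuous.integrable_of_hasCompactSupport (by fun_prop) hc.mul_right

/-- The function `s ↦ g (l * s + b)` on `[-R, R]`. -/
def affineComp (R : ℝ) {g : ℝ → ℝ} (hg : Continuous g) (l b : ℝ) : C(Icc (-R) R, ℝ) :=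
  ⟨fun s => g (l * s + b), by fun_prop⟩

/-- Mollification preserves a closed space of functions that is stable under translations. -/
theorem affineComp_mollification_mem {R : ℝ} {M : Submodule ℝ C(Icc (-R) R, ℝ)}
    (hM : IsClosed (M : Set C(Icc (-R) R, ℝ))) {η τ ρ : ℝ → ℝ} (hη : Continuous η)
    (hc : HasCompactSupport η) (hτ : Continuous τ) (hρ : Continuous ρ)
    (h : ∀ x, ρ x = ∫ t, η t * τ (x - t)) (hmem : ∀ l b, affineComp R hτ l b ∈ M) (l b : ℝ) :
    affineComp R hρ l b ∈ M := by
  have hcont : Continuous fun t => affineComp R hτ l (b - t) :=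
    map_continuous (ContinuousMap.curry (⟨fun p : ℝ × Icc (-R) R => τ (l * p.2 + (b - p.1)),
      by fun_prop⟩ : C(ℝ × Icc (-R) R, ℝ)))
  have hint : Integrable fun t => η t • affineComp R hτ l (b - t) :=
    (hη.smul hcont).integrable_of_hasCompactSupport hc.smul_right
  have e : affineComp R hρ l b = ∫ t, η t • affineComp R hτ l (b - t) := by
    ext s
    have h1 := (ContinuousMap.evalCLM ℝ s).integral_comp_comm hint
    rw [ContinuousMap.evalCLM_apply] at h1
    rw [← h1]
    change ρ (l * s + b) = ∫ t, η t * τ (l * s + (b - t))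
    simp only [h, add_sub_assoc]
  rw [e]
  exact Submodule.integral_mem_of_forall_mem hM fun t => M.smul_mem _ (hmem l (b - t))

/-- Differentiating `s ↦ ρ (l * s + b)` in the parameter `l` produces powers of `s`. -/
theorem pow_mul_iteratedDeriv_mem {R : ℝ} {M : Submodule ℝ C(Icc (-R) R, ℝ)}
    (hM : IsClosed (M : Set C(Icc (-R) R, ℝ))) {ρ : ℝ → ℝ} (hρ : ContDiff ℝ ∞ ρ)
    (hmem : ∀ l b, affineComp R hρ.continuous l b ∈ M) (k : ℕ) (b l : ℝ)
    (f : C(Icc (-R) R, ℝ)) (hf : ∀ s, f s = (s : ℝ) ^ k * iteratedDeriv k ρ (l * s + b)) :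
    f ∈ M := by
  have hd : ∀ k : ℕ, Differentiable ℝ (iteratedDeriv k ρ) := fun k =>
    hρ.differentiable_iteratedDeriv k (by exact_mod_cast WithTop.coe_lt_top _)
  have hcont : ∀ k : ℕ, Continuous (iteratedDeriv k ρ) := fun k => (hd k).continuous
  induction k generalizing l f with
  | zero =>
    convert hmem l b
    ext s
    simp [hf, affineComp]
  | succ k ih =>
    have hk := hcont k
    have hk' := hcont (k + 1)
    have h := ContinuousMap.hasDerivAt_curry (I := Icc (-R) R)
      (Φ := fun p => (p.2 : ℝ) ^ k * iteratedDeriv k ρ (p.1 * p.2 + b))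
      (Ψ := fun p => (p.2 : ℝ) ^ (k + 1) * iteratedDeriv (k + 1) ρ (p.1 * p.2 + b))
      (by fun_prop) (by fun_prop) (fun r s => by
        have h1 : HasDerivAt (fun r : ℝ => r * (s : ℝ) + b) (s : ℝ) r := by
          simpa using ((hasDerivAt_id r).mul_const (s : ℝ)).add_const b
        have h2 := ((hd k (r * s + b)).hasDerivAt.comp r h1).const_mul ((s : ℝ) ^ k)
        rw [← iteratedDeriv_succ] at h2
        refine h2.congr_deriv ?_
        simp only [pow_succ]
        ring) l
    have h3 := Submodule.mem_of_hasDerivAt hM (fun r => ih r _ fun s => by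
      rw [ContinuousMap.curry_apply]; rfl) h
    convert h3
    ext s
    rw [hf, ContinuousMap.curry_apply]
    rfl

/-- Weierstrass' theorem: a closed subspace that contains the monomials is everything. -/
theorem eq_top_of_pow_mem {R : ℝ} {M : Submodule ℝ C(Icc (-R) R, ℝ)}
    (hM : IsClosed (M : Set C(Icc (-R) R, ℝ)))
    (hmem : ∀ (k : ℕ) (f : C(Icc (-R) R, ℝ)), (∀ s, f s = (s : ℝ) ^ k) → f ∈ M) : M = ⊤ := by
  have hpoly : ∀ p : Polynomial ℝ, p.toContinuousMapOn (Icc (-R) R) ∈ M := by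
    intro p
    induction p using Polynomial.induction_on' with
    | add p q hp hq =>
      convert M.add_mem hp hq
      ext s
      simp
    | monomial k a =>
      have : (Polynomial.monomial k a).toContinuousMapOn (Icc (-R) R) =
          a • (⟨fun s => (s : ℝ) ^ k, by fun_prop⟩ : C(Icc (-R) R, ℝ)) := by
        ext s
        simp
      rw [this]
      exact M.smul_mem _ (hmem k _ fun _ => rfl)
  refine eq_top_iff.2 fun f _ => ?_
  have hf : f ∈ (polynomialFunctions (Icc (-R) R)).topologicalClosure := by
    rw [polynomialFunctions_closure_eq_top]
    exact Algebra.mem_top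
  refine closure_minimal (t := (M : Set C(Icc (-R) R, ℝ))) ?_ hM hf
  rintro g hg
  obtain ⟨p, rfl⟩ : g ∈ Set.range (Polynomial.toContinuousMapOnAlgHom (Icc (-R) R)) := by
    rw [← polynomialFunctions_coe]
    exact hg
  exact hpoly p

/-- Among the mollifications of a bounded function `σ` that is not constant there is one that is
not constant, so none of its derivatives vanishes identically. -/
theorem exists_mollification_iteratedDeriv_ne_zero {σ : ℝ → ℝ} (hσ : Continuous σ)
    (hb : ∀ s, σ s ∈ Icc (0 : ℝ) 1) (hne : ∃ s s', σ s ≠ σ s') :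
    ∃ η : ℝ → ℝ, ContDiff ℝ ∞ η ∧ HasCompactSupport η ∧
      ∀ n, ∃ b, iteratedDeriv n (fun x => ∫ t, η t * σ (x - t)) b ≠ 0 := by
  obtain ⟨s, s', hss⟩ := hne
  have hε : 0 < dist (σ s) (σ s') / 3 := by
    have := dist_pos.2 hss
    positivity
  -- A mollification within a third of the oscillation of `σ` still separates `s` and `s'`; being
  -- bounded and nonconstant, it is not a polynomial.
  obtain ⟨δ₁, hδ₁, h₁⟩ := Metric.continuous_iff.1 hσ s _ hε
  obtain ⟨δ₂, hδ₂, h₂⟩ := Metric.continuous_iff.1 hσ s' _ hε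
  let φ : ContDiffBump (0 : ℝ) := ⟨min δ₁ δ₂ / 2, min δ₁ δ₂, by positivity,
    half_lt_self (by positivity)⟩
  refine ⟨φ.normed volume, φ.contDiff_normed, φ.hasCompactSupport_normed, fun n => ?_⟩
  by_contra! hcon
  have e : (fun x => ∫ t, φ.normed volume t * σ (x - t)) =
      convolution (φ.normed volume) σ (ContinuousLinearMap.lsmul ℝ ℝ) volume := rfl
  have hp : ContDiff ℝ ∞ fun x => ∫ t, φ.normed volume t * σ (x - t) := by
    rw [e]
    exact φ.hasCompactSupport_normed.contDiff_convolution_left _ φ.contDiff_normed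
      hσ.locallyIntegrable
  have hbd : ∀ x, |∫ t, φ.normed volume t * σ (x - t)| ≤ 1 := by
    intro x
    have hi : Integrable (φ.normed volume) :=
      (φ.contDiff_normed (n := 0)).continuous.integrable_of_hasCompactSupport
        φ.hasCompactSupport_normed
    rw [← Real.norm_eq_abs, ← φ.integral_normed (μ := volume)]
    refine norm_integral_le_of_norm_le hi (Eventually.of_forall fun t => ?_)
    rw [norm_mul, Real.norm_of_nonneg (φ.nonneg_normed t), Real.norm_of_nonneg (hb _).1]
    exact mul_le_of_le_one_right (φ.nonneg_normed t) (hb _).2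
  have heq := eq_of_iteratedDeriv_eq_zero_of_bounded n hp hbd hcon s s'
  have d₁ := φ.dist_normed_convolution_le (μ := volume) (x₀ := s) (g := σ)
    hσ.aestronglyMeasurable
    fun x hx => (h₁ x ((Metric.mem_ball.1 hx).trans_le (min_le_left _ _))).le
  have d₂ := φ.dist_normed_convolution_le (μ := volume) (x₀ := s') (g := σ)
    hσ.aestronglyMeasurable
    fun x hx => (h₂ x ((Metric.mem_ball.1 hx).trans_le (min_le_right _ _))).le
  rw [← e] at d₁ d₂
  simp only [heq] at d₁
  have d₃ := dist_triangle_left (σ s) (σ s') (∫ t, φ.normed volume t * σ (s' - t))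
  linarith

/-- If `σ` is a bounded function of class `C²` that is not constant, then the functions
`s ↦ σ'' (l * s + b)` with `l ≠ 0` span a dense subspace of `C([-R, R])`. Indeed, the closure of
their span contains the dilates and translates of a mollification `ρ` of `σ''`, hence the
derivatives `s ^ k * ρ⁽ᵏ⁾ (b)` of `ρ (l * s + b)` with respect to `l` at `l = 0`; for each `k` there
is `b` with `ρ⁽ᵏ⁾ (b) ≠ 0`, as `ρ` is the second derivative of a bounded function that is not a
polynomial. -/
theorem topologicalClosure_span_affineComp_eq_top (R : ℝ) {σ : ℝ → ℝ} (hσ : ContDiff ℝ 2 σ)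
    (hb : ∀ s, σ s ∈ Icc (0 : ℝ) 1) (hne : ∃ s s', σ s ≠ σ s')
    (hτ : Continuous (deriv (deriv σ))) :
    (Submodule.span ℝ {f | ∃ l b : ℝ, l ≠ 0 ∧ f = affineComp R hτ l b}).topologicalClosure =
      ⊤ := by
  set S := Submodule.span ℝ {f | ∃ l b : ℝ, l ≠ 0 ∧ f = affineComp R hτ l b}
  set M := S.topologicalClosure
  have hM : IsClosed (M : Set C(Icc (-R) R, ℝ)) := S.isClosed_topologicalClosure
  have h₁ : ∀ l b, l ≠ 0 → affineComp R hτ l b ∈ M := fun l b hl =>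
    S.le_topologicalClosure (Submodule.subset_span ⟨l, b, hl, rfl⟩)
  have h₂ : ∀ l b, affineComp R hτ l b ∈ M := by
    intro l b
    -- The value `l = 0` is included as a limit.
    by_cases hl : l = 0
    · have hcont : Continuous fun l => affineComp R hτ l b :=
        map_continuous (ContinuousMap.curry (⟨fun p : ℝ × Icc (-R) R =>
          deriv (deriv σ) (p.1 * p.2 + b), by fun_prop⟩ : C(ℝ × Icc (-R) R, ℝ)))
      rw [hl]
      refine hM.mem_of_tendsto ((hcont.tendsto 0).mono_left
        (nhdsWithin_le_nhds (s := {0}ᶜ))) ?_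
      filter_upwards [self_mem_nhdsWithin] with l hl
      exact h₁ l b hl
    · exact h₁ l b hl
  obtain ⟨η, hη, hηc, hηn⟩ := exists_mollification_iteratedDeriv_ne_zero hσ.continuous hb hne
  have hσ' : ContDiff ℝ 1 (deriv σ) := ContDiff.deriv' (n := 1) (by norm_num; exact hσ)
  have d₁ := deriv_convolution_eq_convolution_deriv hη hηc (hσ.of_le (by norm_num))
  have d₂ := deriv_convolution_eq_convolution_deriv hη hηc hσ'
  have hρ : ContDiff ℝ ∞ fun x => ∫ t, η t * deriv (deriv σ) (x - t) :=
    hηc.contDiff_convolution_left (ContinuousLinearMap.mul ℝ ℝ) hη hτ.locallyIntegrable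
  have h₃ := affineComp_mollification_mem hM hη.continuous hηc hτ hρ.continuous (fun _ => rfl) h₂
  refine eq_top_of_pow_mem hM fun k f hf => ?_
  obtain ⟨b, hbk⟩ := hηn (k + 1 + 1)
  rw [iteratedDeriv_succ', d₁, iteratedDeriv_succ', d₂] at hbk
  have h₄ := pow_mul_iteratedDeriv_mem hM hρ h₃ k b 0
    (iteratedDeriv k (fun x => ∫ t, η t * deriv (deriv σ) (x - t)) b • f) fun s => by
      rw [ContinuousMap.smul_apply, hf, zero_mul, zero_add, smul_eq_mul, mul_comm]
  exact (Submodule.smul_mem_iff _ hbk).1 h₄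

end OneVariable

/-! ### Approximation of the identity by an activation function -/

section ApproxIdentity

/-- The rescaled activation function `s ↦ (σ (s₀ + δ * s) - σ s₀) / (δ * σ' s₀)`, which tends to
the identity as `δ → 0`. Written with `dslope`, it equals the identity at `δ = 0`. -/
def approxIdentity (σ : ℝ → ℝ) (s₀ δ s : ℝ) : ℝ :=
  s * dslope σ s₀ (s₀ + δ * s) / deriv σ s₀

theorem approxIdentity_zero {σ : ℝ → ℝ} {s₀ : ℝ} (h : deriv σ s₀ ≠ 0) (s : ℝ) :
    approxIdentity σ s₀ 0 s = s := by
  rw [approxIdentity, zero_mul, add_zero, dslope_same, mul_div_assoc, div_self h, mul_one]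

theorem approxIdentity_of_ne_zero (σ : ℝ → ℝ) (s₀ : ℝ) {δ : ℝ} (hδ : δ ≠ 0) (s : ℝ) :
    approxIdentity σ s₀ δ s = (δ * deriv σ s₀)⁻¹ * σ (δ * s + s₀) +
      -((δ * deriv σ s₀)⁻¹ * σ s₀) := by
  rw [approxIdentity]
  by_cases hs : s = 0
  · simp [hs]
  · have hne : s₀ + δ * s ≠ s₀ := by simp [hδ, hs]
    rw [dslope_of_ne _ hne, slope_def_field, add_sub_cancel_left, add_comm (δ * s) s₀, mul_inv,
      div_eq_mul_inv, div_eq_mul_inv, mul_inv]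
    field_simp
    ring

/-- The approximate identities form a `C²` family in `δ`, also at `δ = 0`: the first derivative is
`σ' (δ * s + s₀) / σ' s₀`. So they converge to the identity with two derivatives. -/
theorem isC2Family_approxIdentity {σ : ℝ → ℝ} (hσ : ContDiff ℝ 2 σ) {s₀ : ℝ}
    (h : deriv σ s₀ ≠ 0) : IsC2Family (approxIdentity σ s₀) := by
  have hσ' : ContDiff ℝ 1 (deriv σ) := ContDiff.deriv' (n := 1) (by norm_num; exact hσ)
  have hσ'' : Continuous (deriv (deriv σ)) := hσ'.continuous_deriv le_rfl
  have hσ₁ : Continuous (deriv σ) := hσ'.continuous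
  have hds : Continuous (dslope σ s₀) := by
    rw [← continuousOn_univ, continuousOn_dslope univ_mem]
    exact ⟨hσ.continuous.continuousOn, hσ.differentiable (by norm_num) s₀⟩
  have hlin : ∀ δ s : ℝ, HasDerivAt (fun s => δ * s + s₀) δ s := fun δ s => by
    simpa using ((hasDerivAt_id s).const_mul δ).add_const s₀
  refine IsC2Family.of_hasDerivAt (τ' := fun δ s => deriv σ (δ * s + s₀) / deriv σ s₀)
    (τ'' := fun δ s => deriv (deriv σ) (δ * s + s₀) * δ / deriv σ s₀) ?_ ?_ ?_ ?_ ?_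
  · intro δ s
    by_cases hδ : δ = 0
    · have e : approxIdentity σ s₀ δ = fun s => s := by
        rw [hδ]
        exact funext fun s => approxIdentity_zero h s
      rw [e, hδ, zero_mul, zero_add, div_self h]
      exact hasDerivAt_id s
    · have e : approxIdentity σ s₀ δ = fun s => (δ * deriv σ s₀)⁻¹ * σ (δ * s + s₀) +
          -((δ * deriv σ s₀)⁻¹ * σ s₀) := funext fun s => approxIdentity_of_ne_zero σ s₀ hδ s
      rw [e]
      have h1 := (((hσ.differentiable (by norm_num) (δ * s + s₀)).hasDerivAt.comp s
        (hlin δ s)).const_mul (δ * deriv σ s₀)⁻¹).add_const (-((δ * deriv σ s₀)⁻¹ * σ s₀))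
      refine h1.congr_deriv ?_
      field_simp
  · intro δ s
    exact ((hσ'.differentiable one_ne_zero (δ * s + s₀)).hasDerivAt.comp s
      (hlin δ s)).div_const _
  · simp only [approxIdentity]
    fun_prop
  · fun_prop
  · fun_prop

theorem exists_deriv_ne_zero_of_ne {σ : ℝ → ℝ} (hσ : Differentiable ℝ σ)
    (hne : ∃ s s', σ s ≠ σ s') : ∃ s₀, deriv σ s₀ ≠ 0 := by
  by_contra! h
  obtain ⟨s, s', hss⟩ := hne
  exact hss (is_const_of_deriv_eq_zero hσ h s s')

end ApproxIdentity

/-! ### Ridge functions -/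

section Ridge

variable {d : ℕ} {Q : Set (SpaceTime d)}

theorem H2.ofContDiff_zero (hQ : IsOpen Q) (hb : Bornology.IsBounded Q) :
    H2.ofContDiff hb (fun _ => 0) contDiff_const = 0 :=
  (H2.eq_ofContDiff hQ hb contDiff_const (U := 0)
    (Lp.coeFn_zero ℝ 2 (volume.restrict Q))).symm

theorem fderiv_comp_clm {g : ℝ → ℝ} (hg : Differentiable ℝ g) (ℓ : SpaceTime d →L[ℝ] ℝ)
    (z v : SpaceTime d) : fderiv ℝ (fun z => g (ℓ z)) z v = deriv g (ℓ z) * ℓ v := by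
  have h := ((hg (ℓ z)).hasDerivAt.comp_hasFDerivAt z ℓ.hasFDerivAt).fderiv
  rw [show (fun z => g (ℓ z)) = g ∘ ℓ from rfl, h]
  rfl

theorem fderiv_fderiv_comp_clm {g : ℝ → ℝ} (hg : ContDiff ℝ 2 g) (ℓ : SpaceTime d →L[ℝ] ℝ)
    (z v w : SpaceTime d) : fderiv ℝ (fun z => fderiv ℝ (fun z => g (ℓ z)) z v) z w =
      deriv (deriv g) (ℓ z) * ℓ w * ℓ v := by
  have hg' : ContDiff ℝ 1 (deriv g) := ContDiff.deriv' (n := 1) (by norm_num; exact hg)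
  simp only [fderiv_comp_clm (hg.differentiable (by norm_num))]
  have hd : DifferentiableAt ℝ (fun z => deriv g (ℓ z)) z :=
    ((hg'.differentiable one_ne_zero).comp ℓ.differentiable) z
  rw [fderiv_mul_const hd, _root_.smul_apply,
    fderiv_comp_clm (hg'.differentiable one_ne_zero), smul_eq_mul, mul_comm]

theorem coordDir_norm_le (i : Option (Fin d)) : ‖(coordDir i : SpaceTime d)‖ ≤ 1 := by
  cases i with
  | none => simp [coordDir, Prod.norm_def]
  | some i => simp [coordDir, Prod.norm_def]

/-- For ridge functions, the norm of `H²(Q)` is controlled by the `C²`-norm of the profiles. -/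
theorem H2.exists_norm_ofContDiff_comp_clm_sub_le (hQ : IsOpen Q) (hb : Bornology.IsBounded Q) :
    ∃ A B : ℝ, 0 ≤ A ∧ 0 ≤ B ∧ ∀ (ℓ : SpaceTime d →L[ℝ] ℝ), (∀ z ∈ Q, |ℓ z| ≤ B * ‖ℓ‖) ∧
      ∀ (g₁ g₂ : ℝ → ℝ) (h₁ : ContDiff ℝ 2 g₁) (h₂ : ContDiff ℝ 2 g₂) (C : ℝ), 0 ≤ C →
      (∀ s, |s| ≤ B * ‖ℓ‖ → |g₁ s - g₂ s| ≤ C) →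
      (∀ s, |s| ≤ B * ‖ℓ‖ → |deriv g₁ s - deriv g₂ s| ≤ C) →
      (∀ s, |s| ≤ B * ‖ℓ‖ → |deriv (deriv g₁) s - deriv (deriv g₂) s| ≤ C) →
      ‖H2.ofContDiff hb (fun z => g₁ (ℓ z)) (h₁.comp ℓ.contDiff) -
        H2.ofContDiff hb (fun z => g₂ (ℓ z)) (h₂.comp ℓ.contDiff)‖ ≤
          A * (C * (1 + ‖ℓ‖) ^ 2) := by
  obtain ⟨A, hA, hle⟩ := H2.exists_norm_ofContDiff_sub_le hQ hb
  obtain ⟨B, hB⟩ := hb.exists_norm_le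
  refine ⟨A, max B 0, hA, le_max_right _ _, fun ℓ => ?_⟩
  have hℓ : ∀ z ∈ Q, |ℓ z| ≤ max B 0 * ‖ℓ‖ := fun z hz => by
    rw [mul_comm]
    exact (ℓ.le_opNorm z).trans (mul_le_mul_of_nonneg_left ((hB z hz).trans (le_max_left _ _))
      (norm_nonneg _))
  refine ⟨hℓ, fun g₁ g₂ h₁ h₂ C hC k₀ k₁ k₂ => ?_⟩
  have hi : ∀ i : Option (Fin d), |ℓ (coordDir i)| ≤ 1 + ‖ℓ‖ := fun i => by
    have := ℓ.le_opNorm (coordDir i)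
    have h2 := mul_le_mul_of_nonneg_left (coordDir_norm_le i) (norm_nonneg ℓ)
    rw [Real.norm_eq_abs] at this
    linarith
  have hn := norm_nonneg ℓ
  refine hle _ _ _ _ _ (by positivity) (fun z hz => ?_) (fun z hz i => ?_) (fun z hz i j => ?_)
  · refine (k₀ _ (hℓ z hz)).trans (le_mul_of_one_le_right hC ?_)
    nlinarith
  · rw [fderiv_comp_clm (h₁.differentiable (by norm_num)),
      fderiv_comp_clm (h₂.differentiable (by norm_num)), ← sub_mul, norm_mul, Real.norm_eq_abs,
      Real.norm_eq_abs]
    refine mul_le_mul (k₁ _ (hℓ z hz)) ((hi i).trans ?_) (abs_nonneg _) hC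
    nlinarith
  · rw [fderiv_fderiv_comp_clm h₁, fderiv_fderiv_comp_clm h₂, ← sub_mul, ← sub_mul, norm_mul,
      norm_mul, Real.norm_eq_abs, Real.norm_eq_abs, Real.norm_eq_abs, mul_assoc]
    refine mul_le_mul (k₂ _ (hℓ z hz)) ?_ (by positivity) hC
    rw [sq]
    exact mul_le_mul (hi j) (hi i) (abs_nonneg _) (by positivity)

variable {M : Submodule ℝ (H2 Q)} {σ : ℝ → ℝ}

/-- A constant is a multiple of `σ (0 + b)`, where `b` is chosen such that `σ b ≠ 0`. -/
theorem ofContDiff_const_mem (hQ : IsOpen Q) (hb : Bornology.IsBounded Q)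
    (hne : ∃ s s', σ s ≠ σ s')
    (hmem : ∀ (ℓ : SpaceTime d →L[ℝ] ℝ) (b : ℝ) (h : ContDiff ℝ 2 fun z => σ (ℓ z + b)),
      H2.ofContDiff hb (fun z => σ (ℓ z + b)) h ∈ M) (c : ℝ) :
    H2.ofContDiff hb (fun _ => c) contDiff_const ∈ M := by
  obtain ⟨s, hs⟩ : ∃ s, σ s ≠ 0 := by
    by_contra! h
    obtain ⟨s, s', hss⟩ := hne
    exact hss (by rw [h, h])
  have h := M.smul_mem (c / σ s) (hmem 0 s (by simpa using contDiff_const))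
  rw [← H2.ofContDiff_const_mul hQ] at h
  convert h using 2
  funext z
  simp [hs]

/-- Linear functionals are limits of the approximate identities as `δ → 0`. -/
theorem ofContDiff_clm_mem (hQ : IsOpen Q) (hb : Bornology.IsBounded Q)
    (hM : IsClosed (M : Set (H2 Q))) (hσ : ContDiff ℝ 2 σ) (hne : ∃ s s', σ s ≠ σ s')
    (hmem : ∀ (ℓ : SpaceTime d →L[ℝ] ℝ) (b : ℝ) (h : ContDiff ℝ 2 fun z => σ (ℓ z + b)),
      H2.ofContDiff hb (fun z => σ (ℓ z + b)) h ∈ M) (ℓ : SpaceTime d →L[ℝ] ℝ) :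
    H2.ofContDiff hb (fun z => ℓ z) ℓ.contDiff ∈ M := by
  obtain ⟨s₀, hs₀⟩ := exists_deriv_ne_zero_of_ne (hσ.differentiable (by norm_num)) hne
  have hF : IsC2Family fun (δ : ℝ) (z : SpaceTime d) => approxIdentity σ s₀ δ (ℓ z) :=
    (isC2Family_approxIdentity hσ hs₀).comp (IsC2Family.const ℓ.contDiff)
  have hcont := hF.continuous_ofContDiff hQ hb
  have h0 : H2.ofContDiff hb (fun z => ℓ z) ℓ.contDiff = H2.ofContDiff hb
      (fun z : SpaceTime d => approxIdentity σ s₀ 0 (ℓ z)) (hF.contDiff 0) := by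
    congr 1
    exact funext fun z => (approxIdentity_zero hs₀ _).symm
  rw [h0]
  refine hM.mem_of_tendsto ((hcont.tendsto 0).mono_left (nhdsWithin_le_nhds (s := {0}ᶜ))) ?_
  filter_upwards [self_mem_nhdsWithin] with δ hδ
  have hc : ContDiff ℝ 2 fun z : SpaceTime d => σ ((δ • ℓ) z + s₀) :=
    hσ.comp ((δ • ℓ).contDiff.add contDiff_const)
  have h := M.add_mem (M.smul_mem (δ * deriv σ s₀)⁻¹ (hmem (δ • ℓ) s₀ hc))
    (ofContDiff_const_mem hQ hb hne hmem (-((δ * deriv σ s₀)⁻¹ * σ s₀)))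
  rw [← H2.ofContDiff_const_mul hQ, ← H2.ofContDiff_add hQ] at h
  have e : (fun z : SpaceTime d => approxIdentity σ s₀ δ (ℓ z)) =
      fun z => (δ * deriv σ s₀)⁻¹ * σ ((δ • ℓ) z + s₀) + -((δ * deriv σ s₀)⁻¹ * σ s₀) :=
    funext fun z => approxIdentity_of_ne_zero σ s₀ hδ _
  simp only [e]
  exact h

/-- A combination of dilates and translates of `σ''` is the second derivative of the same
combination of functions `l⁻² σ (l * s + b)`. -/
theorem exists_deriv_deriv_eq_of_mem_span (hQ : IsOpen Q) (hb : Bornology.IsBounded Q)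
    (hσ : ContDiff ℝ 2 σ) (hτ : Continuous (deriv (deriv σ)))
    (hmem : ∀ (ℓ : SpaceTime d →L[ℝ] ℝ) (b : ℝ) (h : ContDiff ℝ 2 fun z => σ (ℓ z + b)),
      H2.ofContDiff hb (fun z => σ (ℓ z + b)) h ∈ M) (ℓ : SpaceTime d →L[ℝ] ℝ) {R : ℝ}
    {f : C(Icc (-R) R, ℝ)}
    (hf : f ∈ Submodule.span ℝ {f | ∃ l b : ℝ, l ≠ 0 ∧ f = affineComp R hτ l b}) :
    ∃ (q : ℝ → ℝ) (hq : ContDiff ℝ 2 q),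
      H2.ofContDiff hb (fun z => q (ℓ z)) (hq.comp ℓ.contDiff) ∈ M ∧
        ∀ s : Icc (-R) R, deriv (deriv q) s = f s := by
  have hderiv : ∀ {q : ℝ → ℝ}, ContDiff ℝ 2 q → ContDiff ℝ 1 (deriv q) := fun hq =>
    ContDiff.deriv' (n := 1) (by norm_num; exact hq)
  induction hf using Submodule.span_induction with
  | mem f hf =>
    obtain ⟨l, b, hl, rfl⟩ := hf
    have hq : ContDiff ℝ 2 fun s => (l ^ 2)⁻¹ * σ (l * s + b) :=
      contDiff_const.mul (hσ.comp ((contDiff_const.mul contDiff_id).add contDiff_const))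
    refine ⟨_, hq, ?_, fun s => ?_⟩
    · have hc : ContDiff ℝ 2 fun z : SpaceTime d => σ ((l • ℓ) z + b) :=
        hσ.comp ((l • ℓ).contDiff.add contDiff_const)
      have h := M.smul_mem (l ^ 2)⁻¹ (hmem (l • ℓ) b hc)
      rw [← H2.ofContDiff_const_mul hQ] at h
      exact h
    · have hlin : ∀ s : ℝ, HasDerivAt (fun s => l * s + b) l s := fun s => by
        simpa using ((hasDerivAt_id s).const_mul l).add_const b
      have e₁ : deriv (fun s => (l ^ 2)⁻¹ * σ (l * s + b)) =
          fun s => (l ^ 2)⁻¹ * (deriv σ (l * s + b) * l) := funext fun s =>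
        (((hσ.differentiable (by norm_num) (l * s + b)).hasDerivAt.comp s (hlin s)).const_mul
          ((l ^ 2)⁻¹)).deriv
      have e₂ := (((((hderiv hσ).differentiable one_ne_zero (l * s + b)).hasDerivAt.comp
        (s : ℝ) (hlin s)).mul_const l).const_mul ((l ^ 2)⁻¹)).deriv
      rw [e₁]
      refine Eq.trans e₂ ?_
      change _ = deriv (deriv σ) (l * s + b)
      field_simp
  | zero =>
    refine ⟨fun _ => 0, contDiff_const, ?_, fun s => by simp⟩
    rw [H2.ofContDiff_zero hQ]
    exact M.zero_mem
  | add f₁ f₂ _ _ ih₁ ih₂ =>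
    obtain ⟨q₁, hq₁, hm₁, e₁⟩ := ih₁
    obtain ⟨q₂, hq₂, hm₂, e₂⟩ := ih₂
    refine ⟨fun s => q₁ s + q₂ s, hq₁.add hq₂, ?_, fun s => ?_⟩
    · have h := M.add_mem hm₁ hm₂
      rwa [← H2.ofContDiff_add hQ] at h
    · have e : deriv (fun s => q₁ s + q₂ s) = fun s => deriv q₁ s + deriv q₂ s := funext fun s =>
        deriv_fun_add (hq₁.differentiable (by norm_num) s) (hq₂.differentiable (by norm_num) s)
      rw [e, deriv_fun_add ((hderiv hq₁).differentiable one_ne_zero s)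
        ((hderiv hq₂).differentiable one_ne_zero s), e₁, e₂]
      rfl
  | smul c f _ ih =>
    obtain ⟨q, hq, hm, e⟩ := ih
    refine ⟨fun s => c * q s, contDiff_const.mul hq, ?_, fun s => ?_⟩
    · have h := M.smul_mem c hm
      rwa [← H2.ofContDiff_const_mul hQ] at h
    · have e' : deriv (fun s => c * q s) = fun s => c * deriv q s := funext fun s =>
        deriv_const_mul c (hq.differentiable (by norm_num) s)
      rw [e', deriv_const_mul c ((hderiv hq).differentiable one_ne_zero s), e]
      rfl

/-- A function of class `C²` on the line whose value and first derivative vanish at `0` is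
controlled on `[-R, R]`, with its first derivative, by its second derivative. -/
theorem norm_le_of_norm_deriv_deriv_le {D : ℝ → ℝ} (hD : ContDiff ℝ 2 D) (h0 : D 0 = 0)
    (h1 : deriv D 0 = 0) {R ε : ℝ} (hε : 0 ≤ ε)
    (h2 : ∀ s ∈ Icc (-R) R, |deriv (deriv D) s| ≤ ε) {s : ℝ} (hs : s ∈ Icc (-R) R) :
    |D s| ≤ ε * (1 + R) ^ 2 ∧ |deriv D s| ≤ ε * (1 + R) ^ 2 := by
  have hD' : ContDiff ℝ 1 (deriv D) := ContDiff.deriv' (n := 1) (by norm_num; exact hD)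
  have hR : 0 ≤ R := by linarith [hs.1, hs.2]
  have hz : (0 : ℝ) ∈ Icc (-R) R := ⟨by linarith, hR⟩
  have b1 : ∀ s ∈ Icc (-R) R, |deriv D s| ≤ ε * R := by
    intro s hs
    have h := (convex_Icc (-R) R).norm_image_sub_le_of_norm_deriv_le
      (fun x _ => hD'.differentiable one_ne_zero x) h2 hz hs
    rw [h1, sub_zero, sub_zero] at h
    exact h.trans (mul_le_mul_of_nonneg_left (abs_le.2 hs) hε)
  have b0 : |D s| ≤ ε * R * R := by
    have h := (convex_Icc (-R) R).norm_image_sub_le_of_norm_deriv_le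
      (fun x _ => hD.differentiable (by norm_num) x) b1 hz hs
    rw [h0, sub_zero, sub_zero] at h
    exact h.trans (mul_le_mul_of_nonneg_left (abs_le.2 hs) (by positivity))
  have b1' := b1 s hs
  have p1 := mul_nonneg hε hR
  have p2 := mul_nonneg p1 hR
  constructor <;> nlinarith

/-- If a closed subspace of `H²(Q)` contains all the functions `σ (ℓ z + b)`, for a bounded
activation function `σ` of class `C²` that is not constant, then it contains all ridge functions
of class `C²`: combinations of dilates and translates of `σ''` approximate `g''` uniformly, and
integrating twice costs an affine function only. -/
theorem ofContDiff_comp_clm_mem (hQ : IsOpen Q) (hb : Bornology.IsBounded Q)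
    (hM : IsClosed (M : Set (H2 Q))) (hσ : ContDiff ℝ 2 σ) (hσb : ∀ s, σ s ∈ Icc (0 : ℝ) 1)
    (hne : ∃ s s', σ s ≠ σ s')
    (hmem : ∀ (ℓ : SpaceTime d →L[ℝ] ℝ) (b : ℝ) (h : ContDiff ℝ 2 fun z => σ (ℓ z + b)),
      H2.ofContDiff hb (fun z => σ (ℓ z + b)) h ∈ M) (ℓ : SpaceTime d →L[ℝ] ℝ)
    {g : ℝ → ℝ} (hg : ContDiff ℝ 2 g) :
    H2.ofContDiff hb (fun z => g (ℓ z)) (hg.comp ℓ.contDiff) ∈ M := by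
  have hderiv : ∀ {q : ℝ → ℝ}, ContDiff ℝ 2 q → ContDiff ℝ 1 (deriv q) := fun hq =>
    ContDiff.deriv' (n := 1) (by norm_num; exact hq)
  have hτ : Continuous (deriv (deriv σ)) := (hderiv hσ).continuous_deriv le_rfl
  obtain ⟨A, B, hA, hB, hle⟩ := H2.exists_norm_ofContDiff_comp_clm_sub_le hQ hb
  obtain ⟨-, hle⟩ := hle ℓ
  set R := B * ‖ℓ‖ with hR
  have hR0 : 0 ≤ R := by positivity
  rw [← SetLike.mem_coe, ← hM.closure_eq, Metric.mem_closure_iff]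
  intro ε hε
  have hg'' : Continuous (deriv (deriv g)) := (hderiv hg).continuous_deriv le_rfl
  have hmem0 : (⟨fun s => deriv (deriv g) s, by fun_prop⟩ : C(Icc (-R) R, ℝ)) ∈
      (Submodule.span ℝ {f | ∃ l b : ℝ, l ≠ 0 ∧ f = affineComp R hτ l b}).topologicalClosure := by
    rw [topologicalClosure_span_affineComp_eq_top R hσ hσb hne hτ]
    exact Submodule.mem_top
  set K := A * ((1 + R) ^ 2 * (1 + ‖ℓ‖) ^ 2) with hK
  have hK0 : 0 ≤ K := by positivity
  have hδ : 0 < ε / (K + 1) := by positivity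
  obtain ⟨f, hf, hfd⟩ := Metric.mem_closure_iff.1 hmem0 _ hδ
  obtain ⟨q, hq, hqM, hqf⟩ := exists_deriv_deriv_eq_of_mem_span hQ hb hσ hτ hmem ℓ hf
  -- The affine function `a * s + c` makes `q + (a * s + c)` agree with `g` at `0` to first order.
  set a := deriv g 0 - deriv q 0 with ha
  set c := g 0 - q 0 with hc
  have hr : ContDiff ℝ 2 fun s => q s + (a * s + c) :=
    hq.add ((contDiff_const.mul contDiff_id).add contDiff_const)
  refine ⟨H2.ofContDiff hb (fun z => q (ℓ z) + (a * ℓ z + c)) (hr.comp ℓ.contDiff), ?_, ?_⟩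
  · have h1 := M.add_mem (M.smul_mem a (ofContDiff_clm_mem hQ hb hM hσ hne hmem ℓ))
      (ofContDiff_const_mem hQ hb hne hmem c)
    rw [← H2.ofContDiff_const_mul hQ, ← H2.ofContDiff_add hQ] at h1
    have h2 := M.add_mem hqM h1
    rwa [← H2.ofContDiff_add hQ] at h2
  · have hr1 : deriv (fun s => q s + (a * s + c)) = fun s => deriv q s + a := funext fun s => by
      have := ((hq.differentiable (by norm_num) s).hasDerivAt.add
        (((hasDerivAt_id s).const_mul a).add_const c)).deriv
      rw [mul_one] at this
      exact this
    have hr2 : deriv (deriv fun s => q s + (a * s + c)) = deriv (deriv q) := by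
      rw [hr1]
      exact funext fun s => deriv_add_const a
    set r := fun s => q s + (a * s + c) with hrdef
    have hD : ContDiff ℝ 2 fun s => g s - r s := hg.sub hr
    have hD1 : deriv (fun s => g s - r s) = fun s => deriv g s - deriv r s := funext fun s =>
      deriv_fun_sub (hg.differentiable (by norm_num) s) (hr.differentiable (by norm_num) s)
    have hD2 : ∀ s, deriv (deriv fun s => g s - r s) s =
        deriv (deriv g) s - deriv (deriv r) s := fun s => by
      rw [hD1]
      exact deriv_fun_sub ((hderiv hg).differentiable one_ne_zero s)
        ((hderiv hr).differentiable one_ne_zero s)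
    have k2 : ∀ s ∈ Icc (-R) R, |deriv (deriv fun s => g s - r s) s| ≤ ε / (K + 1) := by
      intro s hs
      rw [hD2, hr2, hqf ⟨s, hs⟩]
      exact ((ContinuousMap.dist_apply_le_dist
        (f := (⟨fun s => deriv (deriv g) s, by fun_prop⟩ : C(Icc (-R) R, ℝ))) (g := f)
        ⟨s, hs⟩).trans hfd.le)
    have kk := fun s hs => norm_le_of_norm_deriv_deriv_le hD (by simp [hrdef, hc])
      (by rw [hD1]; simp [hr1, ha]) hδ.le k2 (s := s) hs
    rw [dist_eq_norm]
    refine (hle g r hg hr (ε / (K + 1) * (1 + R) ^ 2) (by positivity)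
      (fun s hs => (kk s (abs_le.1 hs)).1)
      (fun s hs => by have := (kk s (abs_le.1 hs)).2; rwa [hD1] at this) (fun s hs => ?_)).trans_lt ?_
    · have h1 := k2 s (abs_le.1 hs)
      rw [hD2] at h1
      refine h1.trans (le_mul_of_one_le_right hδ.le ?_)
      nlinarith
    · have e : A * (ε / (K + 1) * (1 + R) ^ 2 * (1 + ‖ℓ‖) ^ 2) = ε * K / (K + 1) := by
        rw [hK]; ring
      rw [e, div_lt_iff₀ (by positivity)]
      nlinarith

end Ridge

/-! ### Superposition of plane waves -/

section Fourier

open scoped FourierTransform SchwartzMap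

variable {d : ℕ} {Q : Set (SpaceTime d)}

/-- The class in `L²(Q)` of an integral of functions depending on a parameter is the Bochner
integral of the classes. -/
theorem coeFn_integral_toLp_ae_eq {V : Type*} [MeasurableSpace V] {μ : Measure V} [SFinite μ]
    {Φ : V → SpaceTime d → ℝ} (hb : Bornology.IsBounded Q)
    (hΦ : AEStronglyMeasurable (fun p : V × SpaceTime d => Φ p.1 p.2)
      (μ.prod (volume.restrict Q))) {a : V → ℝ} (ha : Integrable a μ)
    (hle : ∀ w z, ‖Φ w z‖ ≤ a w) {φ : SpaceTime d → ℝ} (hφ : ∀ z, φ z = ∫ w, Φ w z ∂μ)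
    (hφm : MemLp φ 2 (volume.restrict Q)) {G : V → L2 Q}
    (hG : ∀ w, G w =ᵐ[volume.restrict Q] Φ w) (hGi : Integrable G μ) :
    (∫ w, G w ∂μ : L2 Q) =ᵐ[volume.restrict Q] φ := by
  have := isFiniteMeasure_restrict_of_isBounded hb
  have key : ∫ w, G w ∂μ = hφm.toLp φ := by
    refine ext_inner_left ℝ fun g => ?_
    have h1 := (innerSL ℝ g).integral_comp_comm hGi
    simp only [innerSL_apply_apply] at h1
    rw [← h1]
    have hgi : Integrable g (volume.restrict Q) :=
      (Lp.memLp g).integrable one_le_two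
    have e1 : ∀ w, inner ℝ g (G w) = ∫ z in Q, g z * Φ w z := fun w => by
      rw [L2.inner_def]
      refine integral_congr_ae ?_
      filter_upwards [hG w] with z hz
      rw [hz]
      simp [mul_comm]
    have e2 : inner ℝ g (hφm.toLp φ) = ∫ z in Q, ∫ w, g z * Φ w z ∂μ := by
      rw [L2.inner_def]
      refine integral_congr_ae ?_
      filter_upwards [hφm.coeFn_toLp] with z hz
      rw [hz, integral_const_mul, ← hφ]
      simp [mul_comm]
    simp only [e1]
    rw [e2]
    refine integral_integral_swap ?_
    refine (ha.mul_prod hgi).mono ?_ (Eventually.of_forall fun p => ?_)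
    · exact ((Lp.aestronglyMeasurable g).comp_quasiMeasurePreserving
        Measure.quasiMeasurePreserving_snd).mul hΦ
    · change ‖g p.2 * Φ p.1 p.2‖ ≤ _
      rw [norm_mul, mul_comm, norm_mul]
      refine mul_le_mul_of_nonneg_right ((hle _ _).trans (le_abs_self _)) (norm_nonneg _)
  rw [key]
  exact hφm.coeFn_toLp

/-- A closed subspace of `H²(Q)` that contains all ridge functions of class `C²` contains all test
functions: by Fourier inversion, a test function is a superposition of the ridge functions
`cos ⟨w, z⟩` and `sin ⟨w, z⟩`. -/
theorem ofContDiff_mem_of_hasCompactSupport (hQ : IsOpen Q) (hb : Bornology.IsBounded Q)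
    {M : Submodule ℝ (H2 Q)} (hM : IsClosed (M : Set (H2 Q)))
    (hmem : ∀ (ℓ : SpaceTime d →L[ℝ] ℝ) (g : ℝ → ℝ) (hg : ContDiff ℝ 2 g),
      H2.ofContDiff hb (fun z => g (ℓ z)) (hg.comp ℓ.contDiff) ∈ M)
    {φ : SpaceTime d → ℝ} (hφ : ContDiff ℝ ∞ φ) (hc : HasCompactSupport φ)
    (hφ2 : ContDiff ℝ 2 φ) : H2.ofContDiff hb φ hφ2 ∈ M := by
  -- The Fourier transform lives on inner product spaces, and the norm of space-time, as a product,
  -- is not Euclidean; so `φ` is transported to a Euclidean space.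
  let A := toEuclidean (E := SpaceTime d)
  let V := EuclideanSpace ℝ (Fin (Module.finrank ℝ (SpaceTime d)))
  have hs₀ : HasCompactSupport fun v : V => φ (A.symm v) :=
    hc.comp_homeomorph A.symm.toHomeomorph
  have hs : HasCompactSupport fun v : V => (φ (A.symm v) : ℂ) :=
    hs₀.comp_left (g := fun r : ℝ => (r : ℂ)) rfl
  have hd : ContDiff ℝ ∞ fun v : V => (φ (A.symm v) : ℂ) :=
    Complex.ofRealCLM.contDiff.comp (hφ.comp A.symm.contDiff)
  let f : 𝓢(V, ℂ) := hs.toSchwartzMap hd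
  let F : 𝓢(V, ℂ) := 𝓕 f
  let ℓ : V → SpaceTime d →L[ℝ] ℝ := fun w =>
    (2 * Real.pi) • (innerSL ℝ w).comp A.toContinuousLinearMap
  have hℓ : Continuous ℓ := by
    have h : Continuous fun w : V => (innerSL ℝ w).comp A.toContinuousLinearMap :=
      (innerSL ℝ (E := V)).continuous.clm_comp continuous_const
    exact h.const_smul (2 * Real.pi)
  have hℓz : ∀ w z, ℓ w z = 2 * Real.pi * inner ℝ w (A z) := fun w z => rfl
  have hFc : Continuous F := F.continuous
  have hd₁ : ∀ (w : V) s,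
      HasDerivAt (fun s => (F w).re * Real.cos s + -((F w).im * Real.sin s))
        ((F w).re * -Real.sin s + -((F w).im * Real.cos s)) s := fun w s =>
    ((Real.hasDerivAt_cos s).const_mul _).add ((Real.hasDerivAt_sin s).const_mul _).neg
  have hd₂ : ∀ (w : V) s,
      HasDerivAt (fun s => (F w).re * -Real.sin s + -((F w).im * Real.cos s))
        ((F w).re * -Real.cos s + -((F w).im * -Real.sin s)) s := fun w s =>
    ((Real.hasDerivAt_sin s).neg.const_mul _).add ((Real.hasDerivAt_cos s).const_mul _).neg
  have hτ : IsC2Family fun (w : V) s => (F w).re * Real.cos s + -((F w).im * Real.sin s) := by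
    have h1 : Continuous fun w => (F w).re := Complex.continuous_re.comp hFc
    have h2 : Continuous fun w => (F w).im := Complex.continuous_im.comp hFc
    exact IsC2Family.of_hasDerivAt hd₁ hd₂ (by fun_prop) (by fun_prop) (by fun_prop)
  have hΦ : IsC2Family fun (w : V) (z : SpaceTime d) =>
      (F w).re * Real.cos (ℓ w z) + -((F w).im * Real.sin (ℓ w z)) :=
    hτ.comp (IsC2Family.clm_apply hℓ)
  have hbound : ∀ w (p q : ℝ), |p| ≤ 1 → |q| ≤ 1 →
      |(F w).re * p + -((F w).im * q)| ≤ 2 * ‖F w‖ := by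
    intro w p q hp hq
    refine (abs_add_le _ _).trans ?_
    rw [abs_neg, abs_mul, abs_mul, two_mul]
    exact add_le_add ((mul_le_of_le_one_right (abs_nonneg _) hp).trans (Complex.abs_re_le_norm _))
      ((mul_le_of_le_one_right (abs_nonneg _) hq).trans (Complex.abs_im_le_norm _))
  have hinv : ∀ z, φ z =
      ∫ w : V, ((F w).re * Real.cos (ℓ w z) + -((F w).im * Real.sin (ℓ w z))) := by
    intro z
    have h1 : 𝓕⁻ (F : V → ℂ) (A z) = f (A z) := by
      rw [← SchwartzMap.fourierInv_coe]
      exact congrArg (fun g : 𝓢(V, ℂ) => g (A z)) (FourierTransform.fourierInv_fourier_eq f)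
    have h2 : f (A z) = (φ z : ℂ) := by
      change ((φ (A.symm (A z)) : ℝ) : ℂ) = _
      rw [A.symm_apply_apply]
    rw [h2, Real.fourierInv_eq'] at h1
    have hi : Integrable fun w : V =>
        Complex.exp (((2 * Real.pi * inner ℝ w (A z) : ℝ) : ℂ) * Complex.I) • F w := by
      refine F.integrable.norm.mono' (by
        refine Continuous.aestronglyMeasurable ?_
        fun_prop) (Eventually.of_forall fun w => ?_)
      rw [norm_smul, Complex.norm_exp_ofReal_mul_I, one_mul]
    have h3 := Complex.reCLM.integral_comp_comm hi
    rw [h1] at h3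
    rw [show φ z = Complex.reCLM (φ z : ℂ) from (Complex.ofReal_re _).symm, ← h3]
    refine integral_congr_ae (Eventually.of_forall fun w => ?_)
    simp only [Complex.reCLM_apply, smul_eq_mul, Complex.mul_re, Complex.exp_ofReal_mul_I_re,
      Complex.exp_ofReal_mul_I_im, hℓz]
    ring
  have hGc := hΦ.continuous_ofContDiff hQ hb
  set G : V → H2 Q := fun w => H2.ofContDiff hb _ (hΦ.contDiff w) with hG
  have hGM : ∀ w, G w ∈ M := fun w => hmem (ℓ w) _ (hτ.contDiff w)
  obtain ⟨B, C, hB, hC, hle⟩ := H2.exists_norm_ofContDiff_comp_clm_sub_le hQ hb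
  -- The norm of `G w` is at most a multiple of `‖F w‖ * (1 + ‖ℓ w‖) ^ 2`, and `F` is a Schwartz
  -- function.
  have hGi : Integrable G := by
    have hi : Integrable fun w : V => B * (2 * ‖F w‖ * (1 + ‖ℓ w‖) ^ 2) := by
      have hℓn : ∀ w, ‖ℓ w‖ ≤ (2 * Real.pi * ‖A.toContinuousLinearMap‖) * ‖w‖ := by
        intro w
        change ‖(2 * Real.pi) • (innerSL ℝ w).comp A.toContinuousLinearMap‖ ≤ _
        rw [norm_smul, Real.norm_of_nonneg Real.two_pi_pos.le, mul_assoc (2 * Real.pi)]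
        refine mul_le_mul_of_nonneg_left ?_ Real.two_pi_pos.le
        refine (ContinuousLinearMap.opNorm_comp_le _ _).trans ?_
        rw [innerSL_apply_norm, mul_comm]
      set D := 2 * Real.pi * ‖A.toContinuousLinearMap‖
      have hD : 0 ≤ D := by positivity
      have hi0 := (((F.integrable_pow_mul volume 0).add
        ((F.integrable_pow_mul volume 1).const_mul (2 * D))).add
        ((F.integrable_pow_mul volume 2).const_mul (D ^ 2))).const_mul (B * 2)
      refine hi0.mono' (by
        refine Continuous.aestronglyMeasurable ?_
        fun_prop) (Eventually.of_forall fun w => ?_)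
      have h1 := hℓn w
      have h2 : (1 + ‖ℓ w‖) ^ 2 ≤ (1 + D * ‖w‖) ^ 2 := by gcongr
      rw [Real.norm_of_nonneg (by positivity)]
      calc B * (2 * ‖F w‖ * (1 + ‖ℓ w‖) ^ 2) ≤ B * (2 * ‖F w‖ * (1 + D * ‖w‖) ^ 2) := by gcongr
        _ = _ := by simp only [Pi.add_apply]; ring
    have : SecondCountableTopologyEither V (H2 Q) := secondCountableTopologyEither_of_left V _
    refine hi.mono' hGc.aestronglyMeasurable (Eventually.of_forall fun w => ?_)
    have e₁ : deriv (fun s => (F w).re * Real.cos s + -((F w).im * Real.sin s)) =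
        fun s => (F w).re * -Real.sin s + -((F w).im * Real.cos s) :=
      funext fun s => (hd₁ w s).deriv
    have h := (hle (ℓ w)).2 _ (fun _ => 0) (hτ.contDiff w) contDiff_const (2 * ‖F w‖)
      (by positivity)
      (fun s _ => by
        simpa using hbound w _ _ (Real.abs_cos_le_one s) (Real.abs_sin_le_one s))
      (fun s _ => by
        rw [e₁, deriv_const, sub_zero]
        exact hbound w _ _ ((abs_neg _).trans_le (Real.abs_sin_le_one s)) (Real.abs_cos_le_one s))
      (fun s _ => by
        rw [e₁, (hd₂ w s).deriv, deriv_const', deriv_const, sub_zero]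
        exact hbound w _ _ ((abs_neg _).trans_le (Real.abs_cos_le_one s))
          ((abs_neg _).trans_le (Real.abs_sin_le_one s)))
    rw [H2.ofContDiff_zero hQ, sub_zero] at h
    exact h
  have hU : ∫ w, G w ∈ M := Submodule.integral_mem_of_forall_mem hM hGM
  -- An element of `H²(Q)` is determined by its class in `L²(Q)`, where the inversion formula holds
  -- pointwise.
  convert hU
  symm
  refine H2.eq_ofContDiff hQ hb hφ2 ?_
  let P : H2 Q →L[ℝ] L2 Q := (ContinuousLinearMap.fst ℝ _ _).comp (H2 Q).subtypeL
  have hP := P.integral_comp_comm hGi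
  have hae := coeFn_integral_toLp_ae_eq hb (μ := (volume : Measure V))
    hΦ.continuous.aestronglyMeasurable (F.integrable.norm.const_mul 2)
    (fun w z => hbound w _ _ (Real.abs_cos_le_one _) (Real.abs_sin_le_one _)) hinv
    (hφ2.continuous.memLp_restrict_of_isBounded hb)
    (G := fun w => P (G w)) (fun w => H2.isClassOf_ofContDiff hb (hΦ.contDiff w))
    (P.integrable_comp hGi)
  rw [hP] at hae
  exact hae

end Fourier

/-! ### Mollification in `L²` -/

section Mollification

theorem eLpNorm_two_sq {α : Type*} [MeasurableSpace α] (μ : Measure α) (f : α → ℝ) :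
    eLpNorm f 2 μ ^ 2 = ∫⁻ x, ‖f x‖ₑ ^ 2 ∂μ := by
  have h := eLpNorm_nnreal_pow_eq_lintegral (f := f) (μ := μ) (p := 2) two_ne_zero
  simpa using h

variable {E : Type*} [NormedAddCommGroup E] [MeasurableSpace E] [BorelSpace E]
  [SecondCountableTopology E]

/-- The distance in `L²` of a function to the mean of its translates is at most the largest
distance to one of these translates: this is Jensen's inequality together with Fubini's theorem. -/
theorem eLpNorm_integral_translate_sub_le {μ : Measure E} [SFinite μ] {u : E → ℝ}
    (hu : Measurable u) {ν : Measure E} [IsProbabilityMeasure ν]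
    (hint : ∀ z, Integrable (fun x => u (z - x)) ν) {ε : ℝ≥0∞}
    (hε : ∀ᵐ x ∂ν, eLpNorm (fun z => u (z - x) - u z) 2 μ ≤ ε) :
    eLpNorm (fun z => (∫ x, u (z - x) ∂ν) - u z) 2 μ ≤ ε := by
  have hm : Measurable fun p : E × E => ‖u (p.1 - p.2) - u p.1‖ₑ ^ 2 := by fun_prop
  have hz : ∀ z, ‖(∫ x, u (z - x) ∂ν) - u z‖ₑ ^ 2 ≤ ∫⁻ x, ‖u (z - x) - u z‖ₑ ^ 2 ∂ν := by
    intro z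
    have e : (∫ x, u (z - x) ∂ν) - u z = ∫ x, (u (z - x) - u z) ∂ν := by
      rw [integral_sub (hint z) (integrable_const _)]
      simp
    have hmz : Measurable fun x => u (z - x) - u z := by fun_prop
    rw [e, ← eLpNorm_two_sq]
    refine pow_le_pow_left' ?_ 2
    refine (enorm_integral_le_lintegral_enorm _).trans ?_
    rw [← eLpNorm_one_eq_lintegral_enorm]
    exact eLpNorm_le_eLpNorm_of_exponent_le one_le_two hmz.aestronglyMeasurable
  have h2 : eLpNorm (fun z => (∫ x, u (z - x) ∂ν) - u z) 2 μ ^ 2 ≤ ε ^ 2 := by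
    rw [eLpNorm_two_sq]
    calc ∫⁻ z, ‖(∫ x, u (z - x) ∂ν) - u z‖ₑ ^ 2 ∂μ
        ≤ ∫⁻ z, ∫⁻ x, ‖u (z - x) - u z‖ₑ ^ 2 ∂ν ∂μ := lintegral_mono hz
      _ = ∫⁻ x, ∫⁻ z, ‖u (z - x) - u z‖ₑ ^ 2 ∂μ ∂ν := lintegral_lintegral_swap hm.aemeasurable
      _ ≤ ∫⁻ _, ε ^ 2 ∂ν := by
        refine lintegral_mono_ae ?_
        filter_upwards [hε] with x hx
        rw [← eLpNorm_two_sq]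
        exact pow_le_pow_left' hx 2
      _ = ε ^ 2 := by simp
  exact (ENNReal.pow_le_pow_left_iff two_ne_zero).1 h2

/-- Translation is continuous in `L²`. -/
theorem tendsto_eLpNorm_translate_sub [LocallyCompactSpace E] {μ : Measure E}
    [μ.IsAddHaarMeasure] {u : E → ℝ} (hu : MemLp u 2 μ) :
    Tendsto (fun x => eLpNorm (fun z => u (z - x) - u z) 2 μ) (𝓝 0) (𝓝 0) := by
  let g : C(E, C(E, E)) := (⟨fun p : E × E => p.2 - p.1, by fun_prop⟩ : C(E × E, E)).curry
  have hg : ∀ x, MeasurePreserving (g x) μ μ := fun x => measurePreserving_sub_right μ x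
  have hc : Continuous fun x => Lp.compMeasurePreserving (g x) (hg x) (hu.toLp u) :=
    continuous_const.compMeasurePreservingLp (map_continuous g) hg (by simp)
  have ht := (tendsto_iff_edist_tendsto_0.1 (hc.tendsto 0))
  refine ht.congr fun x => ?_
  rw [Lp.edist_def]
  refine eLpNorm_congr_ae ?_
  have e : ∀ x, Lp.compMeasurePreserving (g x) (hg x) (hu.toLp u) =ᵐ[μ] fun z => u (z - x) :=
    fun x => (Lp.coeFn_compMeasurePreserving _ (hg x)).trans
      ((hg x).quasiMeasurePreserving.ae_eq_comp hu.coeFn_toLp)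
  filter_upwards [e x, e 0] with z h1 h2
  rw [Pi.sub_apply, h1, h2, sub_zero]

/-- The convolution of a function in `L²(Q)`, extended by zero, with a kernel `k`. -/
def mollify {d : ℕ} {Q : Set (SpaceTime d)} (k : SpaceTime d → ℝ) (a : L2 Q) (z : SpaceTime d) :
    ℝ :=
  ∫ y, Q.indicator a y * k (z - y)

variable {d : ℕ} {Q : Set (SpaceTime d)}

theorem memLp_indicator_L2 (hQ : IsOpen Q) (a : L2 Q) :
    MemLp (Q.indicator a) 2 (volume : Measure (SpaceTime d)) :=
  (memLp_indicator_iff_restrict hQ.measurableSet).2 (Lp.memLp a)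

theorem locallyIntegrable_indicator_L2 (hQ : IsOpen Q) (a : L2 Q) :
    LocallyIntegrable (Q.indicator a) (volume : Measure (SpaceTime d)) :=
  (memLp_indicator_L2 hQ a).locallyIntegrable one_le_two

theorem mollify_eq_convolution (k : SpaceTime d → ℝ) (a : L2 Q) :
    mollify k a = convolution (Q.indicator a) k (ContinuousLinearMap.mul ℝ ℝ) volume := rfl

theorem contDiff_mollify (hQ : IsOpen Q) {k : SpaceTime d → ℝ} (hk : ContDiff ℝ ∞ k)
    (hc : HasCompactSupport k) (a : L2 Q) : ContDiff ℝ ∞ (mollify k a) :=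
  hc.contDiff_convolution_right (ContinuousLinearMap.mul ℝ ℝ) (locallyIntegrable_indicator_L2 hQ a)
    hk

/-- Mollification with a probability density supported near the origin, which need not be centred,
is close to the identity in `L²(Q)`. -/
theorem exists_eLpNorm_mollify_sub_le (hQ : IsOpen Q) (a : L2 Q) {ε : ℝ≥0∞} (hε : 0 < ε) :
    ∃ ρ > 0, ∀ k : SpaceTime d → ℝ, Continuous k → HasCompactSupport k → (∀ x, 0 ≤ k x) →
      ∫ x, k x = 1 → (∀ x, k x ≠ 0 → ‖x‖ < ρ) →
      eLpNorm (fun z => mollify k a z - a z) 2 (volume.restrict Q) ≤ ε := by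
  obtain ⟨ρ, hρ, h⟩ := Metric.eventually_nhds_iff.1
    ((tendsto_eLpNorm_translate_sub (memLp_indicator_L2 hQ a)).eventually (Iic_mem_nhds hε))
  refine ⟨ρ, hρ, fun k hk hc hk0 hk1 hkρ => ?_⟩
  have hu : Measurable (Q.indicator a) :=
    (Lp.stronglyMeasurable a).measurable.indicator hQ.measurableSet
  -- The mollification is the mean of translates with respect to the measure with density `k`.
  set ν : Measure (SpaceTime d) := volume.withDensity fun x => ENNReal.ofReal (k x) with hν
  have hkm : Measurable fun x => ENNReal.ofReal (k x) := by fun_prop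
  have hkt : ∀ᵐ x ∂(volume : Measure (SpaceTime d)), ENNReal.ofReal (k x) < ⊤ :=
    Eventually.of_forall fun x => ENNReal.ofReal_lt_top
  have hν1 : IsProbabilityMeasure ν := ⟨by
    rw [hν, withDensity_apply _ MeasurableSet.univ, Measure.restrict_univ,
      ← ofReal_integral_eq_lintegral_ofReal (hk.integrable_of_hasCompactSupport hc)
        (Eventually.of_forall hk0), hk1, ENNReal.ofReal_one]⟩
  have hint : ∀ z, Integrable (fun x => Q.indicator a (z - x)) ν := by
    intro z
    rw [hν, integrable_withDensity_iff_integrable_smul' hkm hkt]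
    have h1 : Integrable fun x => Q.indicator a x * k (z - x) :=
      hc.convolutionExists_right (ContinuousLinearMap.mul ℝ ℝ)
        (locallyIntegrable_indicator_L2 hQ a) hk z
    have h2 := h1.comp_sub_left z
    refine h2.congr (Eventually.of_forall fun x => ?_)
    simp only [sub_sub_cancel, ENNReal.toReal_ofReal (hk0 x), smul_eq_mul, mul_comm]
  have hmol : ∀ z, mollify k a z = ∫ x, Q.indicator a (z - x) ∂ν := by
    intro z
    rw [hν, integral_withDensity_eq_integral_toReal_smul hkm hkt, mollify,
      ← integral_sub_left_eq_self (fun y => Q.indicator a y * k (z - y)) volume z]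
    refine integral_congr_ae (Eventually.of_forall fun x => ?_)
    simp only [sub_sub_cancel, ENNReal.toReal_ofReal (hk0 x), smul_eq_mul, mul_comm]
  have hae : ∀ᵐ x ∂ν,
      eLpNorm (fun z => Q.indicator a (z - x) - Q.indicator a z) 2 volume ≤ ε := by
    rw [hν, ae_withDensity_iff hkm]
    refine Eventually.of_forall fun x hx => ?_
    refine h ?_
    rw [dist_zero_right]
    exact hkρ x fun h0 => hx (by rw [h0, ENNReal.ofReal_zero])
  have key := eLpNorm_integral_translate_sub_le hu hint hae
  simp only [← hmol] at key
  refine le_trans (le_of_eq ?_) ((eLpNorm_mono_measure _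
    (Measure.restrict_le_self (s := Q))).trans key)
  refine eLpNorm_congr_ae ?_
  filter_upwards [ae_restrict_mem hQ.measurableSet] with z hz
  rw [indicator_of_mem hz]

end Mollification

/-! ### Multiplication by smooth functions and locality -/

section Localization

variable {d : ℕ} {Q : Set (SpaceTime d)}

/-- A smooth function with compact support in an open set that equals one near a given compact
subset. -/
theorem exists_contDiff_cutoff {E : Type*} [NormedAddCommGroup E] [NormedSpace ℝ E]
    [FiniteDimensional ℝ E] {K O : Set E} (hK : IsCompact K) (hO : IsOpen O) (hKO : K ⊆ O) :
    ∃ θ : E → ℝ, ContDiff ℝ ∞ θ ∧ HasCompactSupport θ ∧ tsupport θ ⊆ O ∧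
      ∀ᶠ y in 𝓝ˢ K, θ y = 1 := by
  have : ProperSpace E := FiniteDimensional.proper ℝ E
  obtain ⟨K', hK', hKK', hK'O⟩ := exists_compact_between hK hO hKO
  obtain ⟨f, hf1, hf0, -⟩ := exists_contMDiffMap_one_nhds_of_subset_interior (n := ⊤)
    (modelWithCornersSelf ℝ E) hK.isClosed hKK'
  have hsub : tsupport f ⊆ K' := closure_minimal (fun x hx => by
    by_contra hx'
    exact hx (hf0 x hx')) hK'.isClosed
  exact ⟨f, f.contMDiff.contDiff, hK'.of_isClosed_subset (isClosed_tsupport _) hsub,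
    hsub.trans hK'O, hf1⟩

theorem memLp_mul_L2 {χ : SpaceTime d → ℝ} (hχ : Continuous χ) (hc : HasCompactSupport χ)
    (u : L2 Q) : MemLp (fun z => χ z * u z) 2 (volume.restrict Q) := by
  obtain ⟨C, hC⟩ := hχ.bounded_above_of_compact_support hc
  refine (Lp.memLp u).of_le_mul (c := C) (hχ.aestronglyMeasurable.mul (Lp.aestronglyMeasurable u))
    (Eventually.of_forall fun z => ?_)
  rw [norm_mul]
  exact mul_le_mul_of_nonneg_right (hC z) (norm_nonneg _)

/-- The product of a test function and a function in `L²(Q)`. -/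
def L2.mul {χ : SpaceTime d → ℝ} (hχ : Continuous χ) (hc : HasCompactSupport χ) (u : L2 Q) :
    L2 Q :=
  (memLp_mul_L2 hχ hc u).toLp _

theorem L2.coeFn_mul {χ : SpaceTime d → ℝ} (hχ : Continuous χ) (hc : HasCompactSupport χ)
    (u : L2 Q) : L2.mul hχ hc u =ᵐ[volume.restrict Q] fun z => χ z * u z :=
  (memLp_mul_L2 hχ hc u).coeFn_toLp

theorem continuous_fderiv_apply_of_contDiff {χ : SpaceTime d → ℝ} (hχ : ContDiff ℝ ∞ χ)
    (v : SpaceTime d) : Continuous fun z => fderiv ℝ χ z v :=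
  (hχ.continuous_fderiv (by simp)).clm_apply continuous_const

/-- The product rule for weak derivatives. -/
theorem IsWeakDeriv.mul {v : SpaceTime d} {u w : L2 Q} (h : IsWeakDeriv Q v u w)
    {χ : SpaceTime d → ℝ} (hχ : ContDiff ℝ ∞ χ) (hc : HasCompactSupport χ) :
    IsWeakDeriv Q v (L2.mul hχ.continuous hc u) (L2.mul hχ.continuous hc w +
      L2.mul (continuous_fderiv_apply_of_contDiff hχ v) (hc.fderiv_apply ℝ v) u) := by
  intro φ hφ hφc hφs
  have h0 := h (fun z => χ z * φ z) (hχ.mul hφ) hc.mul_right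
    ((tsupport_mul_subset_right (f := χ) (g := φ)).trans hφs)
  have hd : ∀ z, fderiv ℝ (fun z => χ z * φ z) z v =
      χ z * fderiv ℝ φ z v + φ z * fderiv ℝ χ z v := fun z => by
    rw [fderiv_fun_mul (hχ.differentiable (by simp) z) (hφ.differentiable (by simp) z)]
    simp
  have c1 := continuous_fderiv_apply_of_contDiff hχ v
  have c2 := continuous_fderiv_apply_of_contDiff hφ v
  have i1 : Integrable (fun z => u z * (χ z * fderiv ℝ φ z v)) (volume.restrict Q) :=
    integrable_L2_mul u (hχ.continuous.mul c2) hc.mul_right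
  have i2 : Integrable (fun z => u z * (φ z * fderiv ℝ χ z v)) (volume.restrict Q) :=
    integrable_L2_mul u (hφ.continuous.mul c1) hφc.mul_right
  have i3 : Integrable (fun z => w z * (χ z * φ z)) (volume.restrict Q) :=
    integrable_L2_mul w (hχ.continuous.mul hφ.continuous) hc.mul_right
  have e1 : ∫ z in Q, (L2.mul hχ.continuous hc u) z * fderiv ℝ φ z v =
      ∫ z in Q, u z * (χ z * fderiv ℝ φ z v) := by
    refine integral_congr_ae ?_
    filter_upwards [L2.coeFn_mul hχ.continuous hc u] with z hz
    rw [hz]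
    ring
  have e2 : ∫ z in Q, (L2.mul hχ.continuous hc w + L2.mul c1 (hc.fderiv_apply ℝ v) u : L2 Q) z *
      φ z = (∫ z in Q, w z * (χ z * φ z)) + ∫ z in Q, u z * (φ z * fderiv ℝ χ z v) := by
    rw [← integral_add i3 i2]
    refine integral_congr_ae ?_
    filter_upwards [L2.coeFn_mul hχ.continuous hc w, L2.coeFn_mul c1 (hc.fderiv_apply ℝ v) u,
      Lp.coeFn_add (L2.mul hχ.continuous hc w) (L2.mul c1 (hc.fderiv_apply ℝ v) u)]
      with z h1 h2 h3
    rw [h3, Pi.add_apply, h1, h2]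
    ring
  rw [e1, e2]
  simp only [hd, mul_add] at h0
  rw [integral_add i1 i2] at h0
  linarith

/-- The product of a test function and an element of `H²(Q)`. -/
def H2.mul {χ : SpaceTime d → ℝ} (hχ : ContDiff ℝ ∞ χ) (hc : HasCompactSupport χ) (U : H2 Q) :
    H2 Q :=
  have hχ' : ∀ v : SpaceTime d, ContDiff ℝ ∞ fun z => fderiv ℝ χ z v := fun _ =>
    (hχ.fderiv_right (m := ∞) (by simp)).clm_apply contDiff_const
  ⟨(_, _, _), fun i => (U.2.1 i).mul hχ hc, fun i j => ((U.2.2 i j).mul hχ hc).add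
    ((U.2.1 j).mul (hχ' (coordDir i)) (hc.fderiv_apply ℝ (coordDir i)))⟩

theorem H2.isClassOf_mul {χ : SpaceTime d → ℝ} (hχ : ContDiff ℝ ∞ χ) (hc : HasCompactSupport χ)
    (U : H2 Q) : IsClassOf (H2.mul hχ hc U) fun z => χ z * U.1.1 z :=
  L2.coeFn_mul hχ.continuous hc U.1.1

/-- Weak differentiation does not enlarge supports. -/
theorem IsWeakDeriv.ae_eq_zero_of_notMem (hQ : IsOpen Q) {v : SpaceTime d} {u w : L2 Q}
    (h : IsWeakDeriv Q v u w) {S : Set (SpaceTime d)} (hS : IsClosed S)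
    (hu : ∀ᵐ z ∂(volume.restrict Q), z ∉ S → u z = 0) :
    ∀ᵐ z ∂(volume.restrict Q), z ∉ S → w z = 0 := by
  have key : ∀ᵐ z ∂(volume.restrict Q), z ∈ Q \ S → w z = 0 := by
    refine (hQ.sdiff hS).ae_eq_zero_of_integral_contDiff_smul_eq_zero
      (((Lp.memLp w).locallyIntegrable one_le_two).locallyIntegrableOn _) fun φ hφ hc hs => ?_
    have h0 := h φ hφ hc (hs.trans sdiff_subset)
    have h1 : ∫ z in Q, u z * fderiv ℝ φ z v = 0 := by
      rw [integral_eq_zero_of_ae]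
      filter_upwards [hu] with z hz
      by_cases hzS : z ∈ S
      · have : z ∉ tsupport (fderiv ℝ φ) := fun hz' =>
          (hs (tsupport_fderiv_subset ℝ hz')).2 hzS
        rw [image_eq_zero_of_notMem_tsupport this]
        simp
      · rw [hz hzS, zero_mul]
        rfl
    rw [h1, eq_comm, neg_eq_zero] at h0
    simpa only [smul_eq_mul, mul_comm] using h0
  filter_upwards [key, ae_restrict_mem hQ.measurableSet] with z h1 h2 h3
  exact h1 ⟨h2, h3⟩

/-- Weak differentiation commutes with mollification at those points `z` for which the kernel
`k (z - ·)` meets the support of the function inside `Q` only. -/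
theorem fderiv_mollify_apply (hQ : IsOpen Q) {v : SpaceTime d} {a b : L2 Q}
    (h : IsWeakDeriv Q v a b) {S : Set (SpaceTime d)} (hS : IsClosed S)
    (ha : ∀ᵐ z ∂(volume.restrict Q), z ∉ S → a z = 0)
    {k : SpaceTime d → ℝ} (hk : ContDiff ℝ ∞ k) (hc : HasCompactSupport k) {z : SpaceTime d}
    (hz : ∀ y ∈ S, z - y ∈ tsupport k → y ∈ Q) :
    fderiv ℝ (mollify k a) z v = mollify k b z := by
  have hb := h.ae_eq_zero_of_notMem hQ hS ha
  have hK : IsCompact (S ∩ {y | z - y ∈ tsupport k}) := by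
    have h1 : IsCompact ((fun y => z - y) ⁻¹' tsupport k) :=
      (Homeomorph.subLeft z).isCompact_preimage.2 hc
    exact h1.inter_left hS
  -- As `k (z - ·)` need not be supported in `Q`, it is cut off outside the support of `a` to make
  -- it a test function.
  obtain ⟨θ, hθ, hθc, hθs, hθ1⟩ := exists_contDiff_cutoff hK hQ fun y hy => hz y hy.1 hy.2
  have h1 := (hc.hasFDerivAt_convolution_right (ContinuousLinearMap.mul ℝ ℝ)
    (locallyIntegrable_indicator_L2 hQ a) (hk.of_le (by exact_mod_cast le_top)) z).fderiv
  rw [← mollify_eq_convolution] at h1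
  have hex : ConvolutionExistsAt (Q.indicator a) (fderiv ℝ k) z
      ((ContinuousLinearMap.mul ℝ ℝ).precompR (SpaceTime d)) volume :=
    (hc.fderiv ℝ).convolutionExists_right _ (locallyIntegrable_indicator_L2 hQ a)
      (hk.continuous_fderiv (by simp)) z
  have hkz : ContDiff ℝ ∞ fun y => k (z - y) := hk.comp (contDiff_const.sub contDiff_id)
  have hdk : ∀ y, fderiv ℝ (fun y => k (z - y)) y v = -fderiv ℝ k (z - y) v := fun y => by
    have h3 := ((hk.differentiable (by simp) (z - y)).hasFDerivAt.comp y
      ((hasFDerivAt_id y).const_sub z)).fderiv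
    rw [show (fun y => k (z - y)) = k ∘ fun y => z - y from rfl]
    exact (congrArg (fun T : SpaceTime d →L[ℝ] ℝ => T v) h3).trans (by simp)
  have h2 := h (fun y => θ y * k (z - y)) (hθ.mul hkz) hθc.mul_right
    ((tsupport_mul_subset_left (f := θ)).trans hθs)
  have hset : ∀ (c : L2 Q) (ψ : SpaceTime d → ℝ),
      ∫ y, Q.indicator c y * ψ y = ∫ y in Q, c y * ψ y := fun c ψ => by
    rw [← integral_indicator hQ.measurableSet]
    refine integral_congr_ae (Eventually.of_forall fun y => ?_)
    simp only [indicator_mul_left]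
  have e1 : fderiv ℝ (mollify k a) z v = ∫ y in Q, a y * fderiv ℝ k (z - y) v := by
    rw [h1, convolution_def, ContinuousLinearMap.integral_apply hex]
    simp only [ContinuousLinearMap.precompR_apply]
    exact hset a fun y => fderiv ℝ k (z - y) v
  have e2 : ∫ y in Q, a y * fderiv ℝ (fun y => θ y * k (z - y)) y v =
      - ∫ y in Q, a y * fderiv ℝ k (z - y) v := by
    rw [← integral_neg]
    refine integral_congr_ae ?_
    filter_upwards [ha] with y hy
    by_cases hyS : y ∈ S
    · by_cases hyk : z - y ∈ tsupport k
      · have he : (fun y => θ y * k (z - y)) =ᶠ[𝓝 y] fun y => k (z - y) := by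
          filter_upwards [hθ1.filter_mono (nhds_le_nhdsSet (show y ∈ S ∩ {y | z - y ∈ tsupport k}
            from ⟨hyS, hyk⟩))] with y' hy'
          rw [hy', one_mul]
        rw [he.fderiv_eq, hdk, mul_neg]
      · have hk0 : (fun y => k (z - y)) =ᶠ[𝓝 y] 0 := by
          have h3 := notMem_tsupport_iff_eventuallyEq.1 hyk
          exact (continuous_const.sub continuous_id).continuousAt.eventually h3
        have he : (fun y => θ y * k (z - y)) =ᶠ[𝓝 y] fun y => k (z - y) := by
          filter_upwards [hk0] with y' hy'
          rw [hy']
          simp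
        rw [he.fderiv_eq, hdk, mul_neg]
    · rw [hy hyS]
      simp
  have e3 : ∫ y in Q, b y * (θ y * k (z - y)) = mollify k b z := by
    rw [mollify, hset b fun y => k (z - y)]
    refine integral_congr_ae ?_
    filter_upwards [hb] with y hy
    by_cases hyS : y ∈ S
    · by_cases hyk : z - y ∈ tsupport k
      · rw [hθ1.self_of_nhdsSet y (show y ∈ S ∩ {y | z - y ∈ tsupport k} from ⟨hyS, hyk⟩), one_mul]
      · rw [image_eq_zero_of_notMem_tsupport hyk, mul_zero]
    · rw [hy hyS, zero_mul, zero_mul]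
  rw [e2, e3] at h2
  rw [e1]
  linarith

end Localization

/-! ### The interior cone property -/

section Cone

/-- `Q` has interior cones near `p`: the balls of radius `δ` around `z + δ • c`, for small `δ` and
for the points `z` of `Q` that are near `p`, lie in `Q`. Their union over `δ` is a truncated cone
with vertex `z`, the same one up to translation for all these `z`. -/
def HasConeAt {E : Type*} [NormedAddCommGroup E] [NormedSpace ℝ E] (Q : Set E) (p : E) : Prop :=
  ∃ c : E, ∃ r > 0, ∃ δ₀ > 0, ∀ δ : ℝ, 0 < δ → δ < δ₀ → ∀ z ∈ Q, dist z p < r →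
    ∀ y, ‖y - z - δ • c‖ ≤ δ → y ∈ Q

variable {E F : Type*} [NormedAddCommGroup E] [NormedSpace ℝ E] [NormedAddCommGroup F]
  [NormedSpace ℝ F]

theorem IsOpen.hasConeAt {Q : Set E} (hQ : IsOpen Q) {p : E} (hp : p ∈ Q) : HasConeAt Q p := by
  obtain ⟨R, hR, hs⟩ := Metric.isOpen_iff.1 hQ p hp
  refine ⟨0, R / 2, by positivity, R / 2, by positivity, fun δ _ hδ z _ hz y hy => hs ?_⟩
  rw [smul_zero, sub_zero, ← dist_eq_norm] at hy
  rw [Metric.mem_ball]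
  linarith [dist_triangle y z p]

theorem HasConeAt.prod {A : Set E} {B : Set F} {x : E} {t : F} (hA : HasConeAt A x)
    (hB : HasConeAt B t) : HasConeAt (A ×ˢ B) (x, t) := by
  obtain ⟨c, r, hr, δ₀, hδ₀, h⟩ := hA
  obtain ⟨c', r', hr', δ₀', hδ₀', h'⟩ := hB
  refine ⟨(c, c'), min r r', lt_min hr hr', min δ₀ δ₀', lt_min hδ₀ hδ₀',
    fun δ hδ hδ' z hz hzp y hy => ?_⟩
  obtain ⟨hd, hd'⟩ := max_lt_iff.1 (Prod.dist_eq.symm.trans_lt hzp)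
  have hy1 := (norm_fst_le (y - z - δ • (c, c'))).trans hy
  have hy2 := (norm_snd_le (y - z - δ • (c, c'))).trans hy
  exact ⟨h δ hδ (hδ'.trans_le (min_le_left _ _)) z.1 hz.1 (hd.trans_le (min_le_left _ _)) y.1 hy1,
    h' δ hδ (hδ'.trans_le (min_le_right _ _)) z.2 hz.2 (hd'.trans_le (min_le_right _ _)) y.2 hy2⟩

theorem hasConeAt_Ioo {T : ℝ} (hT : 0 < T) (t : ℝ) : HasConeAt (Ioo 0 T) t := by
  by_cases h : t ≤ T / 2
  · refine ⟨1, T / 4, by positivity, T / 8, by positivity, fun δ hδ hδ' z hz hzt y hy => ?_⟩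
    rw [smul_eq_mul, mul_one, Real.norm_eq_abs, abs_le] at hy
    rw [Real.dist_eq, abs_lt] at hzt
    exact ⟨by linarith [hz.1], by linarith⟩
  · refine ⟨-1, T / 4, by positivity, T / 8, by positivity, fun δ hδ hδ' z hz hzt y hy => ?_⟩
    rw [smul_eq_mul, mul_neg_one, Real.norm_eq_abs, abs_le] at hy
    rw [Real.dist_eq, abs_lt] at hzt
    exact ⟨by linarith, by linarith [hz.2]⟩

/-- Above the graph of a locally Lipschitz function, a cone around the vertical direction that is
steeper than the graph is interior. -/
theorem HasC2Boundary.hasConeAt {d : ℕ} {Ω : Set (EuclideanSpace ℝ (Fin d))}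
    (hΩ : HasC2Boundary Ω) (hΩo : IsOpen Ω) {x : EuclideanSpace ℝ (Fin d)} (hx : x ∈ closure Ω) :
    HasConeAt Ω x := by
  by_cases hxΩ : x ∈ Ω
  · exact hΩo.hasConeAt hxΩ
  obtain ⟨e, he, γ, hγ, r₀, hr₀, hgraph⟩ := hΩ x ⟨hx, by rwa [hΩo.interior_eq]⟩
  set P := (Submodule.span ℝ {e})ᗮ.orthogonalProjectionOnto with hP
  have hPn : ∀ w, ‖P w‖ ≤ ‖w‖ := fun w =>
    Submodule.norm_orthogonalProjectionOnto_apply_le _ w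
  have hPe : P e = 0 := by
    rw [hP, Submodule.orthogonalProjectionOnto_eq_zero_iff]
    simp
  obtain ⟨K, t, ht, hK⟩ := (hγ.contDiffAt (x := P x)).of_le (m := 1) (by norm_num)
    |>.exists_lipschitzOnWith
  obtain ⟨ρ, hρ, hρt⟩ := Metric.mem_nhds_iff.1 ht
  -- The axis `(K + 1) • e` is chosen for the slope `K` of the graph: adding a vector of norm `δ`
  -- lowers the height by `δ` and raises the graph by `K * δ` at most. The strict inequality is
  -- inherited from `z`, which lies strictly above the graph.
  set m := min r₀ ρ with hm
  have hm0 : 0 < m := lt_min hr₀ hρ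
  have hK0 : (0 : ℝ) ≤ K := K.2
  refine ⟨((K : ℝ) + 1) • e, m / 2, by positivity, m / 2 / (K + 2), by positivity,
    fun δ hδ hδ' z hz hzx y hy => ?_⟩
  rw [lt_div_iff₀ (by positivity)] at hδ'
  set w := y - z - δ • ((K : ℝ) + 1) • e with hw
  have hyz : y = z + (δ * ((K : ℝ) + 1)) • e + w := by rw [hw, smul_smul]; abel
  have hdyz : dist y z ≤ δ * (K + 2) := by
    rw [dist_eq_norm, show y - z = (δ * ((K : ℝ) + 1)) • e + w by rw [hyz]; abel]
    refine (norm_add_le _ _).trans ?_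
    rw [norm_smul, he, Real.norm_of_nonneg (by positivity)]
    linarith
  have hzm : dist z x < m := by linarith
  have hym : dist y x < m := by linarith [dist_triangle y z x]
  have hPball : ∀ q, dist q x < m → P q ∈ t := fun q hq => hρt (by
    rw [Metric.mem_ball, dist_eq_norm, ← map_sub]
    exact ((hPn _).trans_lt (by rwa [← dist_eq_norm])).trans_le (min_le_right _ _))
  have hzg := (hgraph z (Metric.mem_ball.2 (hzm.trans_le (min_le_left _ _)))).1 hz
  refine (hgraph y (Metric.mem_ball.2 (hym.trans_le (min_le_left _ _)))).2 ?_
  have hPy : P y = P z + P w := by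
    rw [hyz, map_add, map_add, map_smul, hPe, smul_zero, add_zero]
  have hlip := hK.dist_le_mul _ (hPball y hym) _ (hPball z hzm)
  rw [Real.dist_eq, dist_eq_norm, hPy, add_sub_cancel_left] at hlip
  have h1 : γ (P z + P w) - γ (P z) ≤ K * δ :=
    (le_abs_self _).trans (hlip.trans (mul_le_mul_of_nonneg_left ((hPn w).trans hy) hK0))
  have h2 : inner ℝ e y = inner ℝ e z + δ * (K + 1) + inner ℝ e w := by
    rw [hyz, inner_add_right, inner_add_right, real_inner_smul_right, real_inner_self_eq_norm_sq,
      he]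
    ring
  have h3 : |inner ℝ e w| ≤ δ := by
    have := abs_real_inner_le_norm e w
    rw [he, one_mul] at this
    exact this.trans hy
  have h4 := (abs_le.1 h3).1
  rw [hPy, h2]
  linarith

end Cone

/-! ### Density of smooth functions in `H²(Q)` -/

section Density

variable {d : ℕ} {Q : Set (SpaceTime d)}

theorem eventually_eLpNorm_mollify_sub_le (hQ : IsOpen Q) (a : L2 Q) {ε : ℝ≥0∞} (hε : 0 < ε) :
    ∀ᶠ ρ in 𝓝[>] (0 : ℝ), ∀ k : SpaceTime d → ℝ, Continuous k → HasCompactSupport k →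
      (∀ x, 0 ≤ k x) → ∫ x, k x = 1 → (∀ x, k x ≠ 0 → ‖x‖ < ρ) →
      eLpNorm (fun z => mollify k a z - a z) 2 (volume.restrict Q) ≤ ε := by
  obtain ⟨ρ, hρ, h⟩ := exists_eLpNorm_mollify_sub_le hQ a hε
  filter_upwards [Ioo_mem_nhdsGT hρ] with ρ' hρ' k h1 h2 h3 h4 h5
  exact h k h1 h2 h3 h4 fun x hx => (h5 x hx).trans hρ'.2

theorem exists_kernel (c : SpaceTime d) {δ : ℝ} (hδ : 0 < δ) :
    ∃ k : SpaceTime d → ℝ, ContDiff ℝ ∞ k ∧ HasCompactSupport k ∧ (∀ x, 0 ≤ k x) ∧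
      ∫ x, k x = 1 ∧ tsupport k = Metric.closedBall c δ := by
  let φ : ContDiffBump c := ⟨δ / 2, δ, by positivity, half_lt_self hδ⟩
  exact ⟨φ.normed volume, φ.contDiff_normed, φ.hasCompactSupport_normed, φ.nonneg_normed,
    φ.integral_normed, φ.tsupport_normed_eq⟩

theorem norm_toLp_sub_le_of_eq_mollify (hQ : IsOpen Q) {a : L2 Q} {k ψ : SpaceTime d → ℝ}
    (hψ : MemLp ψ 2 (volume.restrict Q)) (h : ∀ z ∈ Q, ψ z = mollify k a z) {ε : ℝ} (hε : 0 ≤ ε)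
    (hle : eLpNorm (fun z => mollify k a z - a z) 2 (volume.restrict Q) ≤ ENNReal.ofReal ε) :
    ‖hψ.toLp ψ - a‖ ≤ ε := by
  rw [Lp.norm_def]
  refine ENNReal.toReal_le_of_le_ofReal hε (le_trans (le_of_eq ?_) hle)
  refine eLpNorm_congr_ae ?_
  filter_upwards [Lp.coeFn_sub (hψ.toLp ψ) a, hψ.coeFn_toLp, ae_restrict_mem hQ.measurableSet]
    with z h1 h2 h3
  rw [h1, Pi.sub_apply, h2, h z h3]

/-- Near a point with interior cones, an element of `H²(Q)` is approximated by its mollifications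
with kernels that are supported in the reflected cone. -/
theorem HasConeAt.mul_mem (hQ : IsOpen Q) (hb : Bornology.IsBounded Q) {M : Submodule ℝ (H2 Q)}
    (hM : IsClosed (M : Set (H2 Q)))
    (hmem : ∀ (φ : SpaceTime d → ℝ) (_ : ContDiff ℝ ∞ φ) (h : ContDiff ℝ 2 φ),
      H2.ofContDiff hb φ h ∈ M) {p : SpaceTime d} (hp : HasConeAt Q p) :
    ∃ r > 0, ∀ (χ : SpaceTime d → ℝ) (hχ : ContDiff ℝ ∞ χ) (hc : HasCompactSupport χ),
      tsupport χ ⊆ Metric.ball p r → ∀ U : H2 Q, H2.mul hχ hc U ∈ M := by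
  obtain ⟨c, r, hr, δ₀, hδ₀, hcone⟩ := hp
  refine ⟨r / 2, by positivity, fun χ hχ hχc hs U => ?_⟩
  set W := H2.mul hχ hχc U with hW
  set S := tsupport χ with hS
  have hSc : IsClosed S := isClosed_tsupport χ
  have hW0 : ∀ᵐ z ∂(volume.restrict Q), z ∉ S → W.1.1 z = 0 := by
    filter_upwards [H2.isClassOf_mul hχ hχc U] with z hz hzS
    rw [hz, image_eq_zero_of_notMem_tsupport hzS, zero_mul]
  have hW1 : ∀ i, ∀ᵐ z ∂(volume.restrict Q), z ∉ S → W.1.2.1 i z = 0 := fun i =>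
    (W.2.1 i).ae_eq_zero_of_notMem hQ hSc hW0
  rw [← SetLike.mem_coe, ← hM.closure_eq, Metric.mem_closure_iff]
  intro ε hε
  have hε2 : 0 < ENNReal.ofReal (ε / 2) := ENNReal.ofReal_pos.2 (by positivity)
  obtain ⟨ρ, ⟨hρ0, hρ1, hρ2⟩, hρ⟩ :=
    (((eventually_eLpNorm_mollify_sub_le hQ W.1.1 hε2).and
      ((eventually_all.2 fun i => eventually_eLpNorm_mollify_sub_le hQ (W.1.2.1 i) hε2).and
      (eventually_all.2 fun i => eventually_all.2 fun j =>
        eventually_eLpNorm_mollify_sub_le hQ (W.1.2.2 i j) hε2))).and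
      self_mem_nhdsWithin).exists
  -- Points of the ball of radius `δ` around `-(δ • c)` have norm at most `δ * (1 + ‖c‖)`.
  obtain ⟨δ, hδ, hδ'⟩ : ∃ δ : ℝ, 0 < δ ∧ δ < min δ₀ (min (ρ / (1 + ‖c‖)) (r / 2 / (1 + ‖c‖))) := by
    have : 0 < ρ := hρ
    exact exists_between (by positivity)
  obtain ⟨hδ1, hδ2⟩ := lt_min_iff.1 hδ'
  obtain ⟨hδ2, hδ3⟩ := lt_min_iff.1 hδ2
  rw [lt_div_iff₀ (by positivity)] at hδ2 hδ3
  obtain ⟨k, hk, hkc, hk0, hk1, hks⟩ := exists_kernel (-(δ • c)) hδ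
  have hball : ∀ x ∈ tsupport k, ‖x + δ • c‖ ≤ δ ∧ ‖x‖ ≤ δ * (1 + ‖c‖) := fun x hx => by
    rw [hks, Metric.mem_closedBall, dist_eq_norm, sub_neg_eq_add] at hx
    refine ⟨hx, ?_⟩
    have h1 : ‖x‖ ≤ ‖x + δ • c‖ + ‖δ • c‖ := by
      simpa using norm_sub_le (x + δ • c) (δ • c)
    rw [norm_smul, Real.norm_of_nonneg hδ.le] at h1
    linarith
  have hkρ : ∀ x, k x ≠ 0 → ‖x‖ < ρ := fun x hx =>
    (hball x (subset_tsupport k hx)).2.trans_lt hδ2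
  -- At points of `Q`, the mollification of `W` only uses values in `Q`: this is the cone property.
  have hgood : ∀ z ∈ Q, ∀ y ∈ S, z - y ∈ tsupport k → y ∈ Q := by
    intro z hz y hy hzy
    obtain ⟨h1, h2⟩ := hball _ hzy
    refine hcone δ hδ hδ1 z hz ?_ y ?_
    · have h3 := Metric.mem_ball.1 (hs hy)
      rw [← dist_eq_norm] at h2
      linarith [dist_triangle z y p]
    · rw [show y - z - δ • c = -(z - y + δ • c) by abel, norm_neg]
      exact h1
  have hφ : ContDiff ℝ ∞ (mollify k W.1.1) := contDiff_mollify hQ hk hkc _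
  have hφ2 : ContDiff ℝ 2 (mollify k W.1.1) := contDiff_infty.1 hφ 2
  have e1 : ∀ i, ∀ z ∈ Q, fderiv ℝ (mollify k W.1.1) z (coordDir i) =
      mollify k (W.1.2.1 i) z := fun i z hz =>
    fderiv_mollify_apply hQ (W.2.1 i) hSc hW0 hk hkc (hgood z hz)
  have e2 : ∀ i j, ∀ z ∈ Q,
      fderiv ℝ (fun z => fderiv ℝ (mollify k W.1.1) z (coordDir i)) z (coordDir j) =
        mollify k (W.1.2.2 i j) z := fun i j z hz => by
    have he : (fun z => fderiv ℝ (mollify k W.1.1) z (coordDir i)) =ᶠ[𝓝 z]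
        mollify k (W.1.2.1 i) := by
      filter_upwards [hQ.mem_nhds hz] with z' hz'
      exact e1 i z' hz'
    rw [he.fderiv_eq]
    exact fderiv_mollify_apply hQ (W.2.2 i j) hSc (hW1 i) hk hkc (hgood z hz)
  refine ⟨H2.ofContDiff hb _ hφ2, hmem _ hφ hφ2, ?_⟩
  rw [dist_comm, dist_eq_norm]
  refine lt_of_le_of_lt ?_ (half_lt_self hε)
  refine H2.norm_le (by positivity) ?_ (fun i => ?_) (fun i j => ?_)
  · exact norm_toLp_sub_le_of_eq_mollify hQ (hφ2.continuous.memLp_restrict_of_isBounded hb)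
      (fun _ _ => rfl) (by positivity) (hρ0 k hk.continuous hkc hk0 hk1 hkρ)
  · exact norm_toLp_sub_le_of_eq_mollify hQ ((hφ2.contDiff_fderiv_apply_const
      (coordDir i)).continuous.memLp_restrict_of_isBounded hb) (e1 i) (by positivity)
      (hρ1 i k hk.continuous hkc hk0 hk1 hkρ)
  · exact norm_toLp_sub_le_of_eq_mollify hQ ((hφ2.continuous_fderiv_fderiv_apply
      (coordDir i) (coordDir j)).memLp_restrict_of_isBounded hb) (e2 i j) (by positivity)
      (hρ2 i j k hk.continuous hkc hk0 hk1 hkρ)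

/-- On a bounded open set with interior cones, smooth functions on the whole space are dense in
`H²(Q)`. -/
theorem H2.mem_of_hasConeAt (hQ : IsOpen Q) (hb : Bornology.IsBounded Q)
    (hcone : ∀ p ∈ closure Q, HasConeAt Q p) {M : Submodule ℝ (H2 Q)}
    (hM : IsClosed (M : Set (H2 Q)))
    (hmem : ∀ (φ : SpaceTime d → ℝ) (_ : ContDiff ℝ ∞ φ) (h : ContDiff ℝ 2 φ),
      H2.ofContDiff hb φ h ∈ M) (U : H2 Q) : U ∈ M := by
  have hloc := fun p hp => (hcone p hp).mul_mem hQ hb hM hmem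
  choose! r hr hrm using hloc
  obtain ⟨t, htQ, htc⟩ := hb.isCompact_closure.elim_nhds_subcover (fun p => Metric.ball p (r p))
    fun p hp => Metric.ball_mem_nhds p (hr p hp)
  obtain ⟨f, hf⟩ := SmoothPartitionOfUnity.exists_isSubordinate
    (modelWithCornersSelf ℝ (SpaceTime d)) (s := closure Q) isClosed_closure
    (fun p : t => Metric.ball (p : SpaceTime d) (r p)) (fun _ => Metric.isOpen_ball)
    (by simpa [iUnion_subtype] using htc)
  have hfs : ∀ i, ContDiff ℝ ∞ (f i) := fun i => (f i).contMDiff.contDiff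
  have hfc : ∀ i, HasCompactSupport (f i) := fun i =>
    (isCompact_closedBall _ _).of_isClosed_subset (isClosed_tsupport _)
      ((hf i).trans Metric.ball_subset_closedBall)
  have hclass : ∀ s : Finset t, IsClassOf (∑ i ∈ s, H2.mul (hfs i) (hfc i) U)
      fun z => (∑ i ∈ s, f i z) * U.1.1 z := by
    intro s
    classical
    induction s using Finset.induction_on with
    | empty =>
      simp only [Finset.sum_empty, zero_mul]
      exact Lp.coeFn_zero ℝ 2 (volume.restrict Q)
    | insert a s ha ih =>
      rw [Finset.sum_insert ha]
      filter_upwards [ih, H2.isClassOf_mul (hfs a) (hfc a) U,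
        Lp.coeFn_add (H2.mul (hfs a) (hfc a) U).1.1
          (∑ i ∈ s, H2.mul (hfs i) (hfc i) U : H2 Q).1.1] with z h1 h2 h3
      rw [Finset.sum_insert ha, add_mul, ← h1, ← h2]
      exact h3
  have hU : U = ∑ i, H2.mul (hfs i) (hfc i) U := by
    refine H2.ext_of_fst_eq hQ (Lp.ext ?_)
    filter_upwards [hclass Finset.univ, ae_restrict_mem hQ.measurableSet] with z h1 h2
    have h3 := f.sum_eq_one (subset_closure h2)
    rw [finsum_eq_sum_of_fintype] at h3
    rw [h1, h3, one_mul]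
  rw [hU]
  exact M.sum_mem fun i _ => hrm i (htQ i i.2) _ (hfs i) (hfc i) (hf i) U

end Density

/-! ### Deep networks -/

section Networks

variable {d : ℕ} {Q : Set (SpaceTime d)}

/-- The composition of the approximate identities that belong to the first `l` activation
functions. -/
def iteratedApproxIdentity (σ : ℕ → ℝ → ℝ) (s₀ : ℕ → ℝ) : ℕ → ℝ → ℝ → ℝ
  | 0, _, s => s
  | l + 1, δ, s => approxIdentity (σ (l + 1)) (s₀ (l + 1)) δ (iteratedApproxIdentity σ s₀ l δ s)

theorem iteratedApproxIdentity_zero {σ : ℕ → ℝ → ℝ} {s₀ : ℕ → ℝ} {l : ℕ}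
    (h : ∀ k, 1 ≤ k → k ≤ l → deriv (σ k) (s₀ k) ≠ 0) (s : ℝ) :
    iteratedApproxIdentity σ s₀ l 0 s = s := by
  induction l with
  | zero => rfl
  | succ l ih =>
    rw [iteratedApproxIdentity, ih fun k h1 h2 => h k h1 (h2.trans l.le_succ),
      approxIdentity_zero (h (l + 1) (by omega) le_rfl)]

theorem isC2Family_iteratedApproxIdentity {σ : ℕ → ℝ → ℝ} {s₀ : ℕ → ℝ} {l : ℕ}
    (hσ : ∀ k, 1 ≤ k → k ≤ l → ContDiff ℝ 2 (σ k))
    (h : ∀ k, 1 ≤ k → k ≤ l → deriv (σ k) (s₀ k) ≠ 0) :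
    IsC2Family (iteratedApproxIdentity σ s₀ l) := by
  induction l with
  | zero => exact IsC2Family.const contDiff_id
  | succ l ih =>
    exact (isC2Family_approxIdentity (hσ (l + 1) (by omega) le_rfl)
      (h (l + 1) (by omega) le_rfl)).comp
      (ih (fun k h1 h2 => hσ k h1 (h2.trans l.le_succ)) fun k h1 h2 => h k h1 (h2.trans l.le_succ))

/-- For `δ ≠ 0`, the approximate identity, applied to all coordinates, is computed by hidden layers
with diagonal weights, up to an affine function of the outputs, which the following layer can
absorb. -/
theorem exists_hiddenLayers_eq_iteratedApproxIdentity (N : ℕ) (σ : ℕ → ℝ → ℝ) (s₀ : ℕ → ℝ)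
    {δ : ℝ} (hδ : δ ≠ 0) (l : ℕ) :
    ∃ (y : HiddenLayers N l N) (α β : ℝ), ∀ (x : Fin N → ℝ) (j : Fin N),
      α * y.eval σ x j + β = iteratedApproxIdentity σ s₀ l δ (x j) := by
  induction l with
  | zero => exact ⟨.input, 1, 0, fun x j => by rw [one_mul, add_zero]; rfl⟩
  | succ l ih =>
    obtain ⟨y, α, β, h⟩ := ih
    refine ⟨.next y N (Matrix.diagonal fun _ => δ * α) fun _ => δ * β + s₀ (l + 1),
      (δ * deriv (σ (l + 1)) (s₀ (l + 1)))⁻¹,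
      -((δ * deriv (σ (l + 1)) (s₀ (l + 1)))⁻¹ * σ (l + 1) (s₀ (l + 1))), fun x j => ?_⟩
    rw [iteratedApproxIdentity, approxIdentity_of_ne_zero _ _ hδ, ← h, HiddenLayers.eval]
    beta_reduce
    rw [Matrix.mulVec_diagonal]
    congr 3
    ring_nf

/-- The coordinate of the input of a network with a given index, as a linear functional. -/
def inputCoord (d : ℕ) (j : Fin (d + 1)) : SpaceTime d →L[ℝ] ℝ :=
  Fin.lastCases (ContinuousLinearMap.snd ℝ _ _)
    (fun i => (EuclideanSpace.proj i).comp (ContinuousLinearMap.fst ℝ _ _)) j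

theorem inputCoord_apply (j : Fin (d + 1)) (z : SpaceTime d) :
    inputCoord d j z = (Fin.snoc (fun j => z.1 j) z.2 : Fin (d + 1) → ℝ) j := by
  refine Fin.lastCases ?_ (fun i => ?_) j
  · simp [inputCoord]
  · simp [inputCoord]

theorem exists_eq_sum_inputCoord (ℓ : SpaceTime d →L[ℝ] ℝ) :
    ∃ w : Fin (d + 1) → ℝ, ∀ z, ℓ z = ∑ j, w j * inputCoord d j z := by
  refine ⟨Fin.snoc (fun i => ℓ (EuclideanSpace.single i 1, 0)) (ℓ (0, 1)), fun z => ?_⟩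
  have hz : z = (∑ i, z.1 i • ((EuclideanSpace.single i 1, 0) : SpaceTime d)) +
      z.2 • ((0, 1) : SpaceTime d) := by
    refine Prod.ext ?_ ?_
    · ext j
      simp [Prod.fst_sum, Pi.single_apply]
    · simp [Prod.snd_sum]
  conv_lhs => rw [hz]
  rw [map_add, map_sum, Fin.sum_univ_castSucc]
  simp only [map_smul, smul_eq_mul, inputCoord_apply, Fin.snoc_castSucc, Fin.snoc_last]
  congr 1
  · exact Finset.sum_congr rfl fun i _ => mul_comm _ _
  · exact mul_comm _ _

/-- Replacing the input of a network with one hidden layer by the approximate identity gives a deep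
network. -/
theorem exists_network_eval_eq {σ : ℕ → ℝ → ℝ} (s₀ : ℕ → ℝ) {δ : ℝ} (hδ : δ ≠ 0) (m n : ℕ)
    (ξ : Fin n → ℝ) (w : Fin n → Fin (d + 1) → ℝ) (b : Fin n → ℝ) :
    ∃ ψ : Network d (m + 1), ∀ z, ψ.eval σ z = ∑ i, ξ i *
      σ (m + 1) (∑ j, w i j * iteratedApproxIdentity σ s₀ m δ (inputCoord d j z) + b i) := by
  obtain ⟨y, α, β, h⟩ := exists_hiddenLayers_eq_iteratedApproxIdentity (d + 1) σ s₀ hδ m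
  refine ⟨⟨n, .next y n (Matrix.of fun i j => w i j * α) fun i => ∑ j, w i j * β + b i, ξ⟩,
    fun z => ?_⟩
  rw [Network.eval]
  refine Finset.sum_congr rfl fun i _ => ?_
  congr 1
  rw [HiddenLayers.eval]
  simp only [Matrix.mulVec, dotProduct]
  rw [← add_assoc, ← Finset.sum_add_distrib]
  refine congrArg (fun s => σ (m + 1) (s + b i)) (Finset.sum_congr rfl fun j _ => ?_)
  rw [inputCoord_apply, ← h, Matrix.of_apply]
  ring

/-- The elements of `H²(Q)` that are classes of networks of class `C²`. -/
def networkClasses (Q : Set (SpaceTime d)) (depth : ℕ) (σ : ℕ → ℝ → ℝ) : Set (H2 Q) :=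
  {V | ∃ ψ : Network d depth, ContDiff ℝ 2 (ψ.eval σ) ∧ IsClassOf V (ψ.eval σ)}

/-- Networks with one hidden layer, whose activation function is the last one, are limits in
`H²(Q)` of deep networks: the layers before the last one approximate the identity. -/
theorem span_subset_closure_networkClasses (hQ : IsOpen Q) (hb : Bornology.IsBounded Q) {m : ℕ}
    {σ : ℕ → ℝ → ℝ} (hσ : ∀ l, 1 ≤ l → l ≤ m + 1 → ContDiff ℝ 2 (σ l))
    (hne : ∀ l, 1 ≤ l → l ≤ m + 1 → ∃ s s', σ l s ≠ σ l s') :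
    (Submodule.span ℝ {V : H2 Q | ∃ (ℓ : SpaceTime d →L[ℝ] ℝ) (b : ℝ),
      IsClassOf V fun z => σ (m + 1) (ℓ z + b)} : Set (H2 Q)) ⊆
      closure (networkClasses Q (m + 1) σ) := by
  intro V hV
  obtain ⟨n, ξ, g, rfl⟩ := Submodule.mem_span_set'.1 hV
  choose ℓ b hg using fun i => (g i).2
  choose w hw using fun i => exists_eq_sum_inputCoord (ℓ i)
  have hs₀ : ∀ l, ∃ s, 1 ≤ l → l ≤ m → deriv (σ l) s ≠ 0 := by
    intro l
    by_cases hl : 1 ≤ l ∧ l ≤ m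
    · obtain ⟨s, hs⟩ := exists_deriv_ne_zero_of_ne
        ((hσ l hl.1 (by omega)).differentiable (by norm_num)) (hne l hl.1 (by omega))
      exact ⟨s, fun _ _ => hs⟩
    · exact ⟨0, fun h1 h2 => absurd ⟨h1, h2⟩ hl⟩
  choose s₀ hs₀ using hs₀
  have hI := isC2Family_iteratedApproxIdentity (l := m) (fun k h1 h2 => hσ k h1 (by omega)) hs₀
  have hF : ∀ i, IsC2Family fun (δ : ℝ) (z : SpaceTime d) =>
      σ (m + 1) (∑ j, w i j * iteratedApproxIdentity σ s₀ m δ (inputCoord d j z) + b i) := by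
    intro i
    have h1 : IsC2Family fun (δ : ℝ) (z : SpaceTime d) =>
        ∑ j, w i j * iteratedApproxIdentity σ s₀ m δ (inputCoord d j z) :=
      IsC2Family.sum _ fun j => (hI.comp (IsC2Family.const (inputCoord d j).contDiff)).const_mul _
    exact (IsC2Family.const (hσ (m + 1) (by omega) le_rfl)).comp
      (h1.add (IsC2Family.const contDiff_const))
  have hFs : IsC2Family fun (δ : ℝ) (z : SpaceTime d) => ∑ i, ξ i *
      σ (m + 1) (∑ j, w i j * iteratedApproxIdentity σ s₀ m δ (inputCoord d j z) + b i) :=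
    IsC2Family.sum _ fun i => (hF i).const_mul (ξ i)
  have hcont := hFs.continuous_ofContDiff hQ hb
  have h0 : H2.ofContDiff hb _ (hFs.contDiff 0) = ∑ i, ξ i • (g i : H2 Q) := by
    rw [H2.ofContDiff_sum hQ hb Finset.univ fun i => ((hF i).const_mul (ξ i)).contDiff 0]
    refine Finset.sum_congr rfl fun i _ => ?_
    rw [H2.ofContDiff_const_mul hQ hb ((hF i).contDiff 0)]
    congr 1
    refine (H2.eq_ofContDiff hQ hb _ ?_).symm
    convert hg i using 1
    funext z
    simp only [iteratedApproxIdentity_zero hs₀, ← hw]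
  rw [← h0]
  refine mem_closure_of_tendsto ((hcont.tendsto 0).mono_left (nhdsWithin_le_nhds (s := {0}ᶜ))) ?_
  filter_upwards [self_mem_nhdsWithin] with δ hδ
  obtain ⟨ψ, hψ⟩ := exists_network_eval_eq (σ := σ) s₀ hδ m n ξ w b
  have e := funext hψ
  refine ⟨ψ, ?_, ?_⟩
  · rw [e]
    exact hFs.contDiff δ
  · rw [e]
    exact H2.isClassOf_ofContDiff hb _

/-- Smooth functions lie in a closed subspace of `H²(Q)` that contains all ridge functions: on the
bounded set `Q` they agree with test functions. -/
theorem ofContDiff_mem_of_contDiff (hQ : IsOpen Q) (hb : Bornology.IsBounded Q)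
    {M : Submodule ℝ (H2 Q)} (hM : IsClosed (M : Set (H2 Q)))
    (hmem : ∀ (ℓ : SpaceTime d →L[ℝ] ℝ) (g : ℝ → ℝ) (hg : ContDiff ℝ 2 g),
      H2.ofContDiff hb (fun z => g (ℓ z)) (hg.comp ℓ.contDiff) ∈ M)
    {φ : SpaceTime d → ℝ} (hφ : ContDiff ℝ ∞ φ) (hφ2 : ContDiff ℝ 2 φ) :
    H2.ofContDiff hb φ hφ2 ∈ M := by
  obtain ⟨θ, hθ, hθc, -, hθ1⟩ := exists_contDiff_cutoff hb.isCompact_closure isOpen_univ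
    (subset_univ _)
  have h2 : ContDiff ℝ 2 fun z => θ z * φ z := contDiff_infty.1 (hθ.mul hφ) 2
  have h := ofContDiff_mem_of_hasCompactSupport hQ hb hM hmem (hθ.mul hφ) hθc.mul_right h2
  rwa [← H2.eq_ofContDiff hQ hb h2 (U := H2.ofContDiff hb φ hφ2)] at h
  filter_upwards [H2.isClassOf_ofContDiff hb hφ2, ae_restrict_mem hQ.measurableSet] with z h3 h4
  rw [h3, hθ1.self_of_nhdsSet z (subset_closure h4), one_mul]

/-- Deep networks are dense in `H²(Q)`. -/
theorem mem_closure_networkClasses (hQ : IsOpen Q) (hb : Bornology.IsBounded Q)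
    (hcone : ∀ p ∈ closure Q, HasConeAt Q p) {depth : ℕ} (hdepth : 1 ≤ depth) {σ : ℕ → ℝ → ℝ}
    (hσ : ∀ l, 1 ≤ l → l ≤ depth →
      ContDiff ℝ 2 (σ l) ∧ (∀ s, σ l s ∈ Icc (0 : ℝ) 1) ∧ ∃ s s', σ l s ≠ σ l s') (U : H2 Q) :
    U ∈ closure (networkClasses Q depth σ) := by
  obtain ⟨m, rfl⟩ : ∃ m, depth = m + 1 := ⟨depth - 1, by omega⟩
  obtain ⟨h1, h2, h3⟩ := hσ (m + 1) (by omega) le_rfl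
  set N : Submodule ℝ (H2 Q) := Submodule.span ℝ {V : H2 Q |
    ∃ (ℓ : SpaceTime d →L[ℝ] ℝ) (b : ℝ), IsClassOf V fun z => σ (m + 1) (ℓ z + b)}
  have hM : IsClosed (N.topologicalClosure : Set (H2 Q)) := N.isClosed_topologicalClosure
  have hU : U ∈ N.topologicalClosure := by
    refine H2.mem_of_hasConeAt hQ hb hcone hM (fun φ hφ hφ2 => ?_) U
    refine ofContDiff_mem_of_contDiff hQ hb hM (fun ℓ g hg => ?_) hφ hφ2
    refine ofContDiff_comp_clm_mem hQ hb hM h1 h2 h3 (fun ℓ b h => ?_) ℓ hg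
    exact N.le_topologicalClosure (Submodule.subset_span ⟨ℓ, b, H2.isClassOf_ofContDiff hb h⟩)
  exact closure_minimal (span_subset_closure_networkClasses hQ hb
    (fun l k1 k2 => (hσ l k1 k2).1) fun l k1 k2 => (hσ l k1 k2).2.2) isClosed_closure hU

end Networks

/-! ### The cost functional -/

section Cost

variable {d : ℕ}

/-- The cost functional is continuous at a solution of the Cauchy problem, along functions of class
`C²` that converge in `H²(Q)` to the solution: the differential operator is continuous on `H²(Q)`,
and the traces of the solution are the limits of the restrictions of the approximating functions. -/
theorem IsCauchySolution.tendsto_cost {Ω Γ : Set (EuclideanSpace ℝ (Fin d))} {T : ℝ}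
    {L : H2 (stCylinder Ω T) →ₗ[ℝ] L2 (stCylinder Ω T)} {f g : SpaceTime d → ℝ}
    {h : EuclideanSpace ℝ (Fin d) → ℝ} {U : H2 (stCylinder Ω T)}
    (hU : IsCauchySolution Ω Γ T L f g h U) (hL : Continuous L) {φ : ℕ → SpaceTime d → ℝ}
    {V : ℕ → H2 (stCylinder Ω T)} (hφ : ∀ k, ContDiff ℝ 2 (φ k))
    (hV : ∀ k, IsClassOf (V k) (φ k)) (hVU : Tendsto V atTop (𝓝 U)) :
    Tendsto (fun k => cost Ω Γ T L f g h (φ k)) atTop (𝓝 0) := by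
  have hc : Continuous fun V : H2 (stCylinder Ω T) => ‖timeDeriv V + L V‖ₑ ^ 2 := by
    have h1 : Continuous fun V : H2 (stCylinder Ω T) => timeDeriv V := by
      unfold timeDeriv
      fun_prop
    exact (ENNReal.continuous_pow 2).comp (h1.add hL).enorm
  have t1 : Tendsto (fun k => ‖timeDeriv (V k) + L (V k)‖ₑ ^ 2) atTop (𝓝 0) := by
    have := (hc.tendsto U).comp hVU
    rw [hU.equation] at this
    simpa [Function.comp_def] using this
  have sq : ∀ {a : ℕ → ℝ≥0∞}, Tendsto a atTop (𝓝 0) →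
      Tendsto (fun k => a k ^ 2) atTop (𝓝 0) := fun ha => by
    simpa [Function.comp_def] using ((ENNReal.continuous_pow 2).tendsto 0).comp ha
  have t2 := sq (hU.dirichlet φ V hφ hV hVU)
  have t3 := sq (hU.neumann φ V hφ hV hVU)
  have t4 := sq (hU.initial φ V hφ hV hVU)
  have t := ((t1.add t2).add t3).add t4
  simp only [add_zero] at t
  refine tendsto_of_tendsto_of_tendsto_of_le_of_le tendsto_const_nhds t (fun _ => zero_le)
    fun k => ?_
  unfold cost
  gcongr
  exact iInf₂_le (V k) (hV k)

theorem costConst_pos {Ω : Set (EuclideanSpace ℝ (Fin d))} (Γ : Set (EuclideanSpace ℝ (Fin d)))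
    (hΩo : IsOpen Ω) (hΩn : Ω.Nonempty) (hΩb : Bornology.IsBounded Ω) {T : ℝ} :
    0 < costConst Ω Γ T := by
  refine lt_of_lt_of_le ?_ (le_max_right _ _)
  exact ENNReal.toReal_pos (hΩo.measure_pos volume hΩn).ne' hΩb.measure_lt_top.ne

end Cost

theorem mainTheorem3 {d : ℕ} (hd : 0 < d)
    (Ω Γ : Set (EuclideanSpace ℝ (Fin d)))
    (hΩo : IsOpen Ω) (hΩc : IsConnected Ω) (hΩb : Bornology.IsBounded Ω)
    (hΓ : Γ ⊆ frontier Ω) (hΓm : MeasurableSet Γ)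
    (T : ℝ) (hT : 0 < T)
    (L : H2 (stCylinder Ω T) →ₗ[ℝ] L2 (stCylinder Ω T))
    (f g : SpaceTime d → ℝ) (h : EuclideanSpace ℝ (Fin d) → ℝ)
    (hsol : ∃! U : H2 (stCylinder Ω T), IsCauchySolution Ω Γ T L f g h U)
    (hL : ∃ C : ℝ≥0, LipschitzWith C L)
    (hh : ContDiffOn ℝ 2 h (closure Ω))
    (hh' : ∃ M : ℝ, ∀ x ∈ closure Ω, ‖fderivWithin ℝ h (closure Ω) x‖ ≤ M)
    (hΩ2 : HasC2Boundary Ω)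
    (depth : ℕ) (hdepth : 1 ≤ depth) (σ : ℕ → ℝ → ℝ)
    (hσ : ∀ l, 1 ≤ l → l ≤ depth →
      ContDiff ℝ 2 (σ l) ∧ (∀ s, σ l s ∈ Icc (0 : ℝ) 1) ∧ ∃ s s', σ l s ≠ σ l s') :
    ∀ ε : ℝ, 0 < ε → ∃ ψ : ℕ → Network d depth,
      ∀ n, cost Ω Γ T L f g h ((ψ n).eval σ) < ENNReal.ofReal (costConst Ω Γ T * ε) := by
  intro ε hε
  obtain ⟨U, hU, -⟩ := hsol
  obtain ⟨C, hC⟩ := hL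
  have hQ : IsOpen (stCylinder Ω T) := hΩo.prod isOpen_Ioo
  have hb : Bornology.IsBounded (stCylinder Ω T) := hΩb.prod (Metric.isBounded_Ioo 0 T)
  have hcone : ∀ p ∈ closure (stCylinder Ω T), HasConeAt (stCylinder Ω T) p := fun p hp => by
    rw [closure_prod_eq] at hp
    exact (hΩ2.hasConeAt hΩo hp.1).prod (hasConeAt_Ioo hT p.2)
  obtain ⟨V, hV, hVU⟩ := mem_closure_iff_seq_limit.1
    (mem_closure_networkClasses hQ hb hcone hdepth hσ U)
  choose ψ hψ2 hψ using hV
  have ht := hU.tendsto_cost hC.continuous hψ2 hψ hVU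
  have hpos : 0 < ENNReal.ofReal (costConst Ω Γ T * ε) :=
    ENNReal.ofReal_pos.2 (mul_pos (costConst_pos Γ hΩo hΩc.nonempty hΩb) hε)
  obtain ⟨n₀, hn₀⟩ := eventually_atTop.1 (ht.eventually_lt_const hpos)
  exact ⟨fun n => ψ (n₀ + n), fun n => hn₀ _ (Nat.le_add_right _ _)⟩

end
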